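/- Let $\Omega=C_0(\mathbb R_+,\mathbb R^d)$ be the space of continuous paths started at $0$, with the topology of locally uniform convergence, Borel $\sigma$-field $\mathcal F$ and the raw filtration $\mathbb F=(\mathcal F_t)_{t\ge 0}$ generated by the canonical process; let $\mathcal F^*_t$ be the universal completion of $\mathcal F_t$ and $\mathbb F^*=(\mathcal F^*_t)_{t\ge0}$. Stopping times of $\mathbb F$ are finite. For $\omega,\omega'\in\Omega$ and $r\ge 0$ let $\omega\otimes_r\omega'$ be the path equal to $\omega$ on $[0,r)$ and to $\omega_r+\omega'_{\cdot-r}$ on $[r,\infty)$. For an $\mathbb F$-stopping time $\theta$ and a probability measure $P$ on $(\Omega,\mathcal F)$, let $P^{\theta,\omega}(A)=P^\omega_\theta(\omega\otimes_{\theta(\omega)} A)$, where $(P_\theta^\omega)_\omega$ is a regular conditional probability of $P$ given $\mathcal F_\theta$ that is carried by the paths agreeing with $\omega$ on $[0,\theta(\omega)]$. For every $(s,\omega)\in\mathbb R_+\times\Omega$ let $\mathcal Q(s,\omega)$ be a set of probability measures on $(\Omega,\mathcal F)$, with $\mathcal Q(s,\omega)=\mathcal Q(s,\tilde\omega)$ if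 $\omega=\tilde\omega$ on $[0,s]$, and write $\mathcal Q(\tau,\omega)=\mathcal Q(\tau(\omega),\omega)$. Assume that for all $(s,\bar\omega)$, all $\mathbb F$-stopping times $\tau\ge s$ and all $P\in\mathcal Q(s,\bar\omega)$, with $\theta(\omega)=\tau(\bar\omega\otimes_s\omega)-s$: (i) $\{(P',\omega): P'\in\mathcal Q(\tau,\omega)\}$ is analytic; (ii) $P^{\theta,\omega}\in\mathcal Q(\tau,\bar\omega\otimes_s\omega)$ for $P$-a.e. $\omega$; (iii) if $\nu$ is an $\mathcal F_\theta$-measurable kernel with $\nu(\omega)\in\mathcal Q(\tau,\bar\omega\otimes_s\omega)$ for $P$-a.e. $\omega$, then the measure $A\mapsto\int\nu(\omega)\{\omega':\omega\otimes_{\theta(\omega)}\omega'\in A\}\,P(d\omega)$ belongs to $\mathcal Q(s,\bar\omega)$. Let $\mathcal Q=\mathcal Q(0,\cdot)$ (which does not depend on the path). "Quasi-surely" (q.s.) means $Q$-a.s. for all $Q\in\mathcal Q$; every $Q$ is extended to the universally measurable sets. Let $T\ge0$, and let $S=(S_t)_{t\ge0}$ be a real-valued, $\mathbb F^*$-adapted,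 right-continuous process with q.s. continuous paths, such that q.s. $S_t\ge 0$ for all $t\in[0,T]$, and such that for every $Q\in\mathcal Q$ the process $(S_t)_{t\in[0,T]}$ is a $Q$-local martingale for $\mathbb F^*$ (that is, $(S_{t\wedge T})_{t\ge0}$ is one). For $Q\in\mathcal Q$ and an $\mathbb F$-stopping time $\tau\le T$ (in particular $\tau=t$ constant) put $\mathcal Q(\tau,Q)=\{Q'\in\mathcal Q: Q'=Q\text{ on }\mathcal F_\tau\}$. A robust fundamental value of $S$ is an $\mathbb F^*$-adapted process $S^*=(S^*_t)_{t\in[0,T]}$ such that, for every $t\in[0,T]$ and every $Q\in\mathcal Q$, $$S^*_t=\operatorname*{ess\,sup}_{Q'\in\mathcal Q(t,Q)}E_{Q'}[S_T\mid\mathcal F_t]\qquad Q\text{-a.s.},$$ and the robust bubble is $\beta_t=S_t-S^*_t$, $t\in[0,T]$. There is a robust bubble if there are an $\mathbb F$-stopping time $\tau\le T$ and $Q\in\mathcal Q$ such that $Q(S_\tau>S^*_\tau)>0$, where $S^*_\tau$ denotes the robust fundamental value at $\tau$, $S^*_\tau=\operatorname{ess\,sup}_{Q'\in\mathcal Q(\tau,Q)}E_{Q'}[S_T\mid\mathcal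 F_\tau]$ $Q$-a.s. An $\mathbb F^*$-adapted process $(M_t)_{t\in[0,T]}$, with every $M_t$ integrable under every $Q\in\mathcal Q$, is a $\mathcal Q$-martingale if $\sup_{Q\in\mathcal Q}E_Q[M_t]$ is finite for every $t\le T$ and $M_s=\operatorname{ess\,sup}_{Q'\in\mathcal Q(s,Q)}E_{Q'}[M_t\mid\mathcal F_s]$ $Q$-a.s. for all $s\le t\le T$ and $Q\in\mathcal Q$. Then for every robust fundamental value $S^*$ of $S$ and every $Q\in\mathcal Q$: 1. $\beta_t\ge0$ $Q$-a.s. for every $t\in[0,T]$; 2. $(\beta_t)_{t\in[0,T]}$ is a $Q$-local submartingale for $\mathbb F^*$ (that is, $(\beta_{t\wedge T})_{t\ge0}$ is one); 3. $\beta_T=0$ $Q$-a.s. Moreover, if there is a robust bubble, then $(S_t)_{t\in[0,T]}$ is not a $\mathcal Q$-martingale. -/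

import Mathlib

open MeasureTheory ProbabilityTheory Filter Topology
open scoped NNReal ENNReal

namespace RobustBubble

/-! ### Path space -/

/-- The space `C₀(ℝ₊, ℝᵈ)` of continuous paths started at the origin. -/
def PathSpace (d : ℕ) : Type :=
  {ω : C(ℝ≥0, EuclideanSpace ℝ (Fin d)) // ω 0 = 0}

namespace PathSpace

variable {d : ℕ}

/-- The topology of locally uniform convergence (the compact-open topology). -/
instance : TopologicalSpace (PathSpace d) :=
  inferInstanceAs (TopologicalSpace {ω : C(ℝ≥0, EuclideanSpace ℝ (Fin d)) // ω 0 = 0})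

/-- The Borel `σ`-field. -/
instance : MeasurableSpace (PathSpace d) := borel (PathSpace d)

instance : BorelSpace (PathSpace d) := ⟨rfl⟩

instance : CoeFun (PathSpace d) (fun _ => ℝ≥0 → EuclideanSpace ℝ (Fin d)) :=
  ⟨fun ω => ω.1⟩

/-- The zero path. -/
def zero (d : ℕ) : PathSpace d := ⟨ContinuousMap.const _ 0, rfl⟩

instance : PolishSpace (PathSpace d) := by
  have h1 : PolishSpace C(ℝ≥0, EuclideanSpace ℝ (Fin d)) := by
    let _ : UniformSpace C(ℝ≥0, EuclideanSpace ℝ (Fin d)) := inferInstance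
    infer_instance
  have h2 : IsClosed {ω : C(ℝ≥0, EuclideanSpace ℝ (Fin d)) | ω 0 = 0} :=
    isClosed_eq (ContinuousEvalConst.continuous_eval_const 0) continuous_const
  exact h2.polishSpace

theorem continuous_eval (u : ℝ≥0) : Continuous (fun ω : PathSpace d => ω u) :=
  (ContinuousEvalConst.continuous_eval_const u).comp continuous_subtype_val

/-- The concatenation `ω ⊗_r ω'` of two paths at time `r`. -/
def concat (r : ℝ≥0) (ω ω' : PathSpace d) : PathSpace d :=
  ⟨⟨fun u => ω (min u r) + ω' (u - r), by
      have h1 := ω.1.continuous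
      have h2 := ω'.1.continuous
      fun_prop⟩, by
    have h1 := ω.2
    have h2 := ω'.2
    simp [h1, h2]⟩

theorem concat_apply (r : ℝ≥0) (ω ω' : PathSpace d) (u : ℝ≥0) :
    concat r ω ω' u = if u < r then ω u else ω r + ω' (u - r) := by
  have h2 := ω'.2
  change ω (min u r) + ω' (u - r) = _
  split_ifs with h
  · rw [min_eq_left h.le, tsub_eq_zero_of_le h.le, h2, add_zero]
  · rw [min_eq_right (not_lt.mp h)]

/-- The increments of `ω` after time `r`: the path `u ↦ ω (r + u) - ω r`. -/
def shift (r : ℝ≥0) (ω : PathSpace d) : PathSpace d :=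
  ⟨⟨fun u => ω (r + u) - ω r, by
      have h1 := ω.1.continuous
      fun_prop⟩, by simp⟩

theorem continuous_shift (r : ℝ≥0) : Continuous (shift r : PathSpace d → PathSpace d) := by
  refine Continuous.subtype_mk ?_ _
  have h : Continuous (fun ω : PathSpace d =>
      ω.1.comp (⟨fun u => r + u, by fun_prop⟩ : C(ℝ≥0, ℝ≥0))
        - ContinuousMap.const ℝ≥0 (ω r)) := by
    refine Continuous.sub ?_ ?_
    · exact (ContinuousMap.continuous_precomp _).comp continuous_subtype_val
    · exact ContinuousMap.continuous_const'.comp (continuous_eval r)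
  exact h

end PathSpace

open PathSpace

/-- The raw filtration `𝔽 = (F_t)` generated by the canonical process. -/
def rawFiltration (d : ℕ) : Filtration ℝ≥0 (borel (PathSpace d)) where
  seq t := ⨆ u : {u : ℝ≥0 // u ≤ t},
    MeasurableSpace.comap (fun ω : PathSpace d => ω u.1) (borel (EuclideanSpace ℝ (Fin d)))
  mono' := fun _ t hst => iSup_le fun u =>
    le_iSup (fun u : {u : ℝ≥0 // u ≤ t} =>
      MeasurableSpace.comap (fun ω : PathSpace d => ω u.1) (borel (EuclideanSpace ℝ (Fin d))))
      ⟨u.1, u.2.trans hst⟩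
  le' := fun _ => iSup_le fun u => (continuous_eval u.1).borel_measurable.comap_le

/-- A finite stopping time of the raw filtration. -/
def IsRawStoppingTime {d : ℕ} (τ : PathSpace d → ℝ≥0) : Prop :=
  IsStoppingTime (rawFiltration d) (fun ω => (τ ω : WithTop ℝ≥0))

/-- The `σ`-field `F_τ` of a stopping time of the raw filtration. -/
@[reducible] def rawSigma {d : ℕ} {τ : PathSpace d → ℝ≥0} (hτ : IsRawStoppingTime τ) :
    MeasurableSpace (PathSpace d) :=
  IsStoppingTime.measurableSpace hτ

/-- The random time `θ = τ^{s,ω₀} - s`, i.e. `θ(ω) = τ(ω₀ ⊗_s ω) - s`. -/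
def residualTime {d : ℕ} (s : ℝ≥0) (ω₀ : PathSpace d) (τ : PathSpace d → ℝ≥0) :
    PathSpace d → ℝ≥0 :=
  fun ω => τ (concat s ω₀ ω) - s

theorem isRawStoppingTime_residualTime {d : ℕ} (s : ℝ≥0) (ω₀ : PathSpace d)
    {τ : PathSpace d → ℝ≥0} (hτ : IsRawStoppingTime τ) :
    IsRawStoppingTime (residualTime s ω₀ τ) := by
  intro t
  have hmeas : @Measurable _ _ (rawFiltration d t) (rawFiltration d (t + s))
      (fun ω => concat s ω₀ ω) := by
    rw [measurable_iff_comap_le]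
    change MeasurableSpace.comap _ (⨆ u : {u : ℝ≥0 // u ≤ t + s}, _) ≤ _
    rw [MeasurableSpace.comap_iSup]
    refine iSup_le fun u => ?_
    rw [MeasurableSpace.comap_comp, ← measurable_iff_comap_le]
    have hu : u.1 - s ≤ t := tsub_le_iff_right.mpr u.2
    have h1 : @Measurable _ _ (rawFiltration d t) (borel (EuclideanSpace ℝ (Fin d)))
        (fun ω : PathSpace d => ω (u.1 - s)) := by
      rw [measurable_iff_comap_le]
      exact le_iSup (fun v : {u : ℝ≥0 // u ≤ t} =>
        MeasurableSpace.comap (fun ω : PathSpace d => ω v.1)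
          (borel (EuclideanSpace ℝ (Fin d)))) ⟨u.1 - s, hu⟩
    have h2 : @Measurable _ _ (borel (EuclideanSpace ℝ (Fin d)))
        (borel (EuclideanSpace ℝ (Fin d)))
        (fun x : EuclideanSpace ℝ (Fin d) => ω₀ (min u.1 s) + x) :=
      (continuous_const.add continuous_id).borel_measurable
    exact fun A hA => h1 (h2 hA)
  have h := hmeas (hτ (t + s))
  convert h using 1
  ext ω
  simp only [residualTime, Set.mem_ofPred_eq, Set.mem_preimage, WithTop.coe_le_coe]
  exact tsub_le_iff_right

/-- The probability measure `P^{θ,ω}`: the law, under a regular conditional distribution of `P`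
given `F_θ` at `ω`, of the increments after time `θ ω`. As the regular conditional distribution
is carried by the paths that agree with `ω` up to `θ ω`, this is
`A ↦ P_θ^ω(ω ⊗_θ A)`; it is determined for `P`-almost every `ω`. -/
noncomputable def shiftedConditional {d : ℕ} (P : ProbabilityMeasure (PathSpace d))
    {θ : PathSpace d → ℝ≥0} (hθ : IsRawStoppingTime θ) (ω : PathSpace d) :
    ProbabilityMeasure (PathSpace d) :=
  ProbabilityMeasure.map
    (⟨condExpKernel (P : Measure (PathSpace d)) (rawSigma hθ) ω, inferInstance⟩ :
      ProbabilityMeasure (PathSpace d))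
    (f := shift (θ ω)) (continuous_shift (θ ω)).measurable.aemeasurable

/-- The standing assumption on a family `(𝒬(s, ω))` of sets of probability measures: it is
non-anticipative, its graphs along stopping times are analytic, and it is invariant under
conditioning and stable under pasting. -/
structure IsStableFamily {d : ℕ}
    (𝒬 : ℝ≥0 → PathSpace d → Set (ProbabilityMeasure (PathSpace d))) : Prop where
  nonanticipative : ∀ (s : ℝ≥0) (ω ω' : PathSpace d),
    (∀ u ≤ s, ω u = ω' u) → 𝒬 s ω = 𝒬 s ω'
  analytic : ∀ τ : PathSpace d → ℝ≥0, IsRawStoppingTime τ →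
    AnalyticSet {p : ProbabilityMeasure (PathSpace d) × PathSpace d | p.1 ∈ 𝒬 (τ p.2) p.2}
  invariance : ∀ (s : ℝ≥0) (ω₀ : PathSpace d) (τ : PathSpace d → ℝ≥0)
    (hτ : IsRawStoppingTime τ), (∀ ω, s ≤ τ ω) → ∀ P ∈ 𝒬 s ω₀,
    ∀ᵐ ω ∂(P : Measure (PathSpace d)),
      shiftedConditional P (isRawStoppingTime_residualTime s ω₀ hτ) ω ∈
        𝒬 (τ (concat s ω₀ ω)) (concat s ω₀ ω)
  pasting : ∀ (s : ℝ≥0) (ω₀ : PathSpace d) (τ : PathSpace d → ℝ≥0)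
    (hτ : IsRawStoppingTime τ), (∀ ω, s ≤ τ ω) → ∀ P ∈ 𝒬 s ω₀,
    ∀ ν : PathSpace d → ProbabilityMeasure (PathSpace d),
      (∀ A : Set (PathSpace d), MeasurableSet A →
        Measurable[rawSigma (isRawStoppingTime_residualTime s ω₀ hτ)]
          (fun ω => (ν ω : Measure (PathSpace d)) A)) →
      (∀ᵐ ω ∂(P : Measure (PathSpace d)),
        ν ω ∈ 𝒬 (τ (concat s ω₀ ω)) (concat s ω₀ ω)) →
      ∀ P' : ProbabilityMeasure (PathSpace d),
        (∀ A : Set (PathSpace d), MeasurableSet A →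
          (P' : Measure (PathSpace d)) A =
            ∫⁻ ω, (ν ω : Measure (PathSpace d))
              {ω' | concat (residualTime s ω₀ τ ω) ω ω' ∈ A} ∂(P : Measure (PathSpace d))) →
        P' ∈ 𝒬 s ω₀

/-- The set of priors `𝒬 = 𝒬(0, ω)`, which does not depend on `ω` as all paths start at `0`. -/
def priors {d : ℕ} (𝒬 : ℝ≥0 → PathSpace d → Set (ProbabilityMeasure (PathSpace d))) :
    Set (ProbabilityMeasure (PathSpace d)) :=
  𝒬 0 (PathSpace.zero d)

/-! ### Universal completion -/

/-- The universal completion of a `σ`-field: the intersection of its completions under all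
probability measures on it. -/
@[reducible] def universalCompletion {Ω : Type*} (m : MeasurableSpace Ω) : MeasurableSpace Ω where
  MeasurableSet' A := ∀ P : @Measure Ω m, @IsProbabilityMeasure Ω m P → NullMeasurableSet A P
  measurableSet_empty := fun _ _ => nullMeasurableSet_empty
  measurableSet_compl := fun _ h P hP => (h P hP).compl
  measurableSet_iUnion := fun _ h P hP => NullMeasurableSet.iUnion fun i => h i P hP

theorem le_universalCompletion {Ω : Type*} (m : MeasurableSpace Ω) :
    m ≤ universalCompletion m :=
  fun _ hA _ _ => MeasurableSet.nullMeasurableSet hA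

theorem universalCompletion_mono {Ω : Type*} {m₁ m₂ : MeasurableSpace Ω} (h : m₁ ≤ m₂) :
    universalCompletion m₁ ≤ universalCompletion m₂ := by
  intro A hA P hP
  have h1 : @NullMeasurableSet Ω m₁ A (P.trim h) := hA _
    (@IsProbabilityMeasure.mk _ m₁ _ ((trim_measurableSet_eq h MeasurableSet.univ).trans measure_univ))
  obtain ⟨B, hB, hAB⟩ := h1
  exact ⟨B, h _ hB, ae_eq_of_ae_eq_trim hAB⟩

/-- The filtration `𝔽* = (F*_t)` of the universal completions of the raw `σ`-fields. -/
def starFiltration (d : ℕ) : Filtration ℝ≥0 (universalCompletion (borel (PathSpace d))) where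
  seq t := universalCompletion (rawFiltration d t)
  mono' := fun _ _ hst => universalCompletion_mono ((rawFiltration d).mono hst)
  le' := fun t => universalCompletion_mono ((rawFiltration d).le t)

/-- The unique extension of a Borel probability measure to the universally measurable sets. -/
noncomputable def ext {d : ℕ} (P : ProbabilityMeasure (PathSpace d)) :
    @Measure (PathSpace d) (universalCompletion (borel (PathSpace d))) :=
  @Measure.mk (PathSpace d) (universalCompletion (borel (PathSpace d)))
    (P : Measure (PathSpace d)).toOuterMeasure
    (fun _ hs hd => measure_iUnion₀ (hd.mono fun _ _ h => h.aedisjoint)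
      (fun i => hs i (P : Measure (PathSpace d)) inferInstance))
    (by
      nth_rewrite 2 [← (P : Measure (PathSpace d)).trimmed]
      exact OuterMeasure.trim_anti_measurableSpace _ (le_universalCompletion _))

theorem ext_apply {d : ℕ} (P : ProbabilityMeasure (PathSpace d)) (A : Set (PathSpace d)) :
    ext P A = (P : Measure (PathSpace d)) A := rfl

instance {d : ℕ} (P : ProbabilityMeasure (PathSpace d)) :
    @IsProbabilityMeasure (PathSpace d) (universalCompletion (borel (PathSpace d))) (ext P) :=
  @IsProbabilityMeasure.mk _ (_) _ ((ext_apply P Set.univ).trans measure_univ)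

/-! ### Local martingales on `[0, T]` -/

/-- `(X_t)_{t ∈ [0,T]}` is a `Q`-local martingale for `𝔽*`: the process `(X_{t ∧ T})_{t ≥ 0}` is
a local martingale. -/
def IsLocalMartingaleOn {d : ℕ} (T : ℝ≥0) (X : ℝ≥0 → PathSpace d → ℝ)
    (Q : ProbabilityMeasure (PathSpace d)) : Prop :=
  Locally (fun Y : ℝ≥0 → PathSpace d → ℝ => Martingale Y (starFiltration d) (ext Q))
    (starFiltration d) (fun t => X (min t T)) (ext Q)

/-- `(X_t)_{t ∈ [0,T]}` is a `Q`-local submartingale for `𝔽*`: the process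
`(X_{t ∧ T})_{t ≥ 0}` is a local submartingale. -/
def IsLocalSubmartingaleOn {d : ℕ} (T : ℝ≥0) (X : ℝ≥0 → PathSpace d → ℝ)
    (Q : ProbabilityMeasure (PathSpace d)) : Prop :=
  Locally (fun Y : ℝ≥0 → PathSpace d → ℝ => Submartingale Y (starFiltration d) (ext Q))
    (starFiltration d) (fun t => X (min t T)) (ext Q)

/-! ### Robust fundamental value and robust bubbles -/

/-- `V` is (a version of) the `μ`-essential supremum of the family `𝒴` of random variables. -/
def IsEssSupOf {Ω : Type*} {m : MeasurableSpace Ω} (μ : Measure Ω) (𝒴 : Set (Ω → ℝ))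
    (V : Ω → ℝ) : Prop :=
  AEMeasurable V μ ∧ (∀ Y ∈ 𝒴, Y ≤ᵐ[μ] V) ∧
    ∀ Z : Ω → ℝ, AEMeasurable Z μ → (∀ Y ∈ 𝒴, Y ≤ᵐ[μ] Z) → V ≤ᵐ[μ] Z

/-- The set `{Q' ∈ 𝒬₀ : Q' = Q on m}`. -/
def agreeingPriors {d : ℕ} (𝒬₀ : Set (ProbabilityMeasure (PathSpace d)))
    (Q : ProbabilityMeasure (PathSpace d)) (m : MeasurableSpace (PathSpace d)) :=
  {Q' ∈ 𝒬₀ | ∀ A, MeasurableSet[m] A → ext Q' A = ext Q A}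

/-- `V = ess sup {E_{Q'}[ξ | m] : Q' ∈ 𝒬₀, Q' = Q on m}`, `Q`-almost surely. -/
def IsConditionalSublinearExpectation {d : ℕ} (𝒬₀ : Set (ProbabilityMeasure (PathSpace d)))
    (Q : ProbabilityMeasure (PathSpace d)) (m : MeasurableSpace (PathSpace d))
    (ξ V : PathSpace d → ℝ) : Prop :=
  IsEssSupOf (ext Q) {Y | ∃ Q' ∈ agreeingPriors 𝒬₀ Q m, Y = (ext Q')[ξ | m]} V

/-- `S*` is the robust fundamental value of `S` on `[0, T]`: an `𝔽*`-adapted process with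
`S*_t = ess sup {E_{Q'}[S_T | F_t] : Q' ∈ 𝒬(t, Q)}` `Q`-a.s. for all `t ≤ T` and all priors `Q`. -/
structure IsRobustFundamentalValue {d : ℕ} (𝒬₀ : Set (ProbabilityMeasure (PathSpace d)))
    (T : ℝ≥0) (S Sstar : ℝ≥0 → PathSpace d → ℝ) : Prop where
  adapted : ∀ t ≤ T, Measurable[starFiltration d t] (Sstar t)
  eq_essSup : ∀ t ≤ T, ∀ Q ∈ 𝒬₀,
    IsConditionalSublinearExpectation 𝒬₀ Q (rawFiltration d t) (S T) (Sstar t)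

/-- There is a robust bubble: `Q(S_τ > S*_τ) > 0` for a stopping time `τ ≤ T` and a prior `Q`,
where `S*_τ` is the robust fundamental value at time `τ`, that is
`S*_τ = ess sup {E_{Q'}[S_T | F_τ] : Q' ∈ 𝒬(τ, Q)}` `Q`-a.s. -/
def HasRobustBubble {d : ℕ} (𝒬₀ : Set (ProbabilityMeasure (PathSpace d)))
    (T : ℝ≥0) (S : ℝ≥0 → PathSpace d → ℝ) : Prop :=
  ∃ (τ : PathSpace d → ℝ≥0) (hτ : IsRawStoppingTime τ), (∀ ω, τ ω ≤ T) ∧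
    ∃ Q ∈ 𝒬₀, ∃ V : PathSpace d → ℝ,
      IsConditionalSublinearExpectation 𝒬₀ Q (rawSigma hτ) (S T) V ∧
      0 < ext Q {ω | V ω < S (τ ω) ω}

/-- At deterministic times, a positive probability of `S_t > S*_t` is a robust bubble. -/
theorem IsRobustFundamentalValue.hasRobustBubble {d : ℕ}
    {𝒬₀ : Set (ProbabilityMeasure (PathSpace d))} {T : ℝ≥0} {S Sstar : ℝ≥0 → PathSpace d → ℝ}
    (h : IsRobustFundamentalValue 𝒬₀ T S Sstar) {t : ℝ≥0} (ht : t ≤ T)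
    {Q : ProbabilityMeasure (PathSpace d)} (hQ : Q ∈ 𝒬₀)
    (hpos : 0 < ext Q {ω | Sstar t ω < S t ω}) : HasRobustBubble 𝒬₀ T S := by
  have hτ : IsRawStoppingTime (fun _ : PathSpace d => t) := isStoppingTime_const _ t
  have hm : rawSigma hτ = rawFiltration d t := IsStoppingTime.measurableSpace_const _ t
  refine ⟨fun _ => t, hτ, fun _ => ht, Q, hQ, Sstar t, ?_, hpos⟩
  rw [hm]
  exact h.eq_essSup t ht Q hQ

/-- `(M_t)_{t ∈ [0,T]}` is a `𝒬`-martingale: it is `𝔽*`-adapted, `ℰ_0(M_t) = sup_Q E_Q[M_t]` is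
finite, and `M_s = ℰ_s(M_t)` quasi-surely for `s ≤ t ≤ T`. -/
structure IsRobustMartingaleOn {d : ℕ} (𝒬₀ : Set (ProbabilityMeasure (PathSpace d)))
    (T : ℝ≥0) (M : ℝ≥0 → PathSpace d → ℝ) : Prop where
  adapted : ∀ t ≤ T, Measurable[starFiltration d t] (M t)
  integrable : ∀ t ≤ T, ∀ Q ∈ 𝒬₀, Integrable (M t) (ext Q)
  bddAbove : ∀ t ≤ T, BddAbove {x : ℝ | ∃ Q ∈ 𝒬₀, x = ∫ ω, M t ω ∂(ext Q)}
  eq_essSup : ∀ s t, s ≤ t → t ≤ T → ∀ Q ∈ 𝒬₀,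
    IsConditionalSublinearExpectation 𝒬₀ Q (rawFiltration d s) (M t) (M s)

end RobustBubble

/-!
The two halves of the theorem rest on the same property of the family of priors: if two priors agree
on `F_t`, one may be replaced by the other on an event of `F_t` (`exists_paste`). This follows from
invariance under conditioning and stability under pasting at a deterministic time; the membership of
conditional distributions is transferred between priors with a common past by the observation that a
conditional distribution given `F_t` is carried by a single atom of `F_t`
(`conditionalShift_mem`). Consequently the conditional expectations of a variable under the priors
agreeing on `F_t` with a given one are directed upwards, and the expectation of their essential
supremum is approached by a single prior (`exists_integral_le_add`).

Under every prior the price process `S` is a nonnegative local martingale started at a constant,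
hence a supermartingale (`supermartingale_of_locally`). So `S t` dominates every conditional
expectation of `S T`, and therefore their essential supremum, the fundamental value, with equality
at `t = T`. A prior that is nearly optimal at time `t` competes in the essential supremum at any
earlier time, which makes the fundamental value a supermartingale under every prior
(`fundamentalValue_supermartingale`).

The bubble is thus a continuous local martingale minus a supermartingale. The difficulty in
localizing it is that the fundamental value has no path regularity at all, so that stopping it at an
arbitrary stopping time makes no sense almost surely. Optional stopping does hold for such processes
at stopping times with countably many values (`Submartingale.stoppedProcess_of_countable`), and the
continuity of `S` allows one to choose countably valued localizing times before which `S`, hence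
also the smaller nonnegative fundamental value, is bounded (`exists_countable_passage_time`,
`locally_submartingale_sub`).

If `S` is a robust martingale, then at each deterministic time `t` some prior with the same past has
`E[S T | F_t]` close to `S t`. For a stopping time `τ ≤ T`, such priors are pasted at the grid times
following `τ` (`exists_paste_along_times`). As `S` is right-continuous, Fatou's lemma shows that
`S τ` is dominated by the supremum of the conditional expectations of `S T` given `F_τ` under the
pasted priors (`le_of_robustMartingale`), which excludes a bubble.
-/

namespace RobustBubble

open PathSpace

/-! ### Paths and the raw filtration -/

section Paths

variable {d : ℕ}

theorem PathSpace.ext_path {ω ω' : PathSpace d} (h : ∀ u, ω u = ω' u) : ω = ω' :=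
  Subtype.ext (ContinuousMap.ext h)

/-- A map into path space is Borel as soon as its coordinates are measurable. The coordinates at a
countable dense set of times form an injective Borel map into a Polish space, and such a map is a
measurable embedding by the Lusin–Souslin theorem. -/
theorem PathSpace.measurable_of_eval {α : Type*} [MeasurableSpace α] {f : α → PathSpace d}
    (hf : ∀ u, Measurable fun a => f a u) : Measurable f := by
  let g : PathSpace d → ℕ → EuclideanSpace ℝ (Fin d) :=
    fun ω n => ω (TopologicalSpace.denseSeq ℝ≥0 n)
  have hg : Measurable g := measurable_pi_lambda _ fun n => (continuous_eval _).measurable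
  have hinj : Function.Injective g := by
    intro ω ω' h
    have h1 : (ω : ℝ≥0 → EuclideanSpace ℝ (Fin d)) = ω' :=
      Continuous.ext_on (TopologicalSpace.denseRange_denseSeq ℝ≥0) ω.1.continuous
        ω'.1.continuous (by rintro _ ⟨n, rfl⟩; exact congrFun h n)
    exact PathSpace.ext_path fun u => congrFun h1 u
  have he : MeasurableEmbedding g := hg.measurableEmbedding hinj
  rw [← he.measurable_comp_iff]
  exact measurable_pi_lambda _ fun n => hf _

theorem measurable_eval_rawFiltration {u t : ℝ≥0} (h : u ≤ t) :
    Measurable[rawFiltration d t] (fun ω : PathSpace d => ω u) := by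
  rw [measurable_iff_comap_le, BorelSpace.measurable_eq (α := EuclideanSpace ℝ (Fin d))]
  exact le_iSup (fun v : {u : ℝ≥0 // u ≤ t} =>
    MeasurableSpace.comap (fun ω : PathSpace d => ω v.1)
      (borel (EuclideanSpace ℝ (Fin d)))) ⟨u, h⟩

/-- The path `ω` stopped at time `t`. -/
def stopPath (t : ℝ≥0) (ω : PathSpace d) : PathSpace d :=
  concat t ω (PathSpace.zero d)

theorem stopPath_apply (t : ℝ≥0) (ω : PathSpace d) (u : ℝ≥0) :
    stopPath t ω u = ω (min u t) := by
  change ω (min u t) + (0 : EuclideanSpace ℝ (Fin d)) = _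
  rw [add_zero]

theorem concat_shift_of_agree {t : ℝ≥0} {ω ω' : PathSpace d} (h : ∀ u ≤ t, ω u = ω' u) :
    concat t ω (shift t ω') = ω' := by
  refine PathSpace.ext_path fun u => ?_
  rw [concat_apply]
  split_ifs with hu
  · exact h u hu.le
  · change ω t + (ω' (t + (u - t)) - ω' t) = ω' u
    rw [add_tsub_cancel_of_le (not_lt.mp hu), h t le_rfl]
    abel

theorem concat_zero_time (ω₀ ω : PathSpace d) : concat 0 ω₀ ω = ω := by
  refine PathSpace.ext_path fun u => ?_
  rw [concat_apply, if_neg not_lt_zero, ω₀.2, zero_add, tsub_zero]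

/-- Every event of `F_t` is a union of sets of paths with common restriction to `[0, t]`. -/
theorem mem_iff_of_agree {t : ℝ≥0} {A : Set (PathSpace d)} (hA : MeasurableSet[rawFiltration d t] A)
    {ω ω' : PathSpace d} (h : ∀ u ≤ t, ω u = ω' u) : ω ∈ A ↔ ω' ∈ A := by
  let m : MeasurableSpace (PathSpace d) :=
    { MeasurableSet' := fun A => ω ∈ A ↔ ω' ∈ A
      measurableSet_empty := Iff.rfl
      measurableSet_compl := fun A hA => not_congr hA
      measurableSet_iUnion := fun f hf => by simp only [Set.mem_iUnion]; exact exists_congr hf }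
  have hle : rawFiltration d t ≤ m := by
    refine iSup_le fun u => ?_
    rintro _ ⟨B, _, rfl⟩
    change ω u.1 ∈ B ↔ ω' u.1 ∈ B
    rw [h u.1 u.2]
  exact hle A hA

/-- The events of the universal completion of `F_t` are also determined by the restriction of the
path to `[0, t]`: they are measurable for the completion under a Dirac measure, whose null events
in `F_t` miss the whole atom. -/
theorem mem_iff_of_agree_star {t : ℝ≥0} {A : Set (PathSpace d)}
    (hA : MeasurableSet[starFiltration d t] A)
    {ω ω' : PathSpace d} (h : ∀ u ≤ t, ω u = ω' u) : ω ∈ A ↔ ω' ∈ A := by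
  let μ : @Measure (PathSpace d) (rawFiltration d t) := @Measure.dirac _ (rawFiltration d t) ω
  have hμ : @IsProbabilityMeasure _ (rawFiltration d t) μ :=
    @Measure.dirac.isProbabilityMeasure _ (rawFiltration d t) ω
  obtain ⟨B, hB, hAB⟩ : @NullMeasurableSet _ (rawFiltration d t) A μ := hA μ hμ
  have hnull : μ {x | A x = B x}ᶜ = 0 := hAB
  obtain ⟨N, hsub, hN, hN0⟩ := @exists_measurable_superset_of_null _ (rawFiltration d t) μ _ hnull
  have hωN : ω ∉ N := by
    intro hmem
    have : μ N = 1 := by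
      rw [@Measure.dirac_apply' _ (rawFiltration d t) _ ω hN]
      simp [hmem]
    simp [hN0] at this
  have hω'N : ω' ∉ N := fun h' => hωN ((mem_iff_of_agree hN h).mpr h')
  have h1 : A ω = B ω := by by_contra hc; exact hωN (hsub hc)
  have h2 : A ω' = B ω' := by by_contra hc; exact hω'N (hsub hc)
  exact (iff_of_eq h1).trans ((mem_iff_of_agree hB h).trans (iff_of_eq h2).symm)

theorem eq_of_agree_star {t : ℝ≥0} {f : PathSpace d → ℝ}
    (hf : Measurable[starFiltration d t] f)
    {ω ω' : PathSpace d} (h : ∀ u ≤ t, ω u = ω' u) : f ω = f ω' :=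
  ((mem_iff_of_agree_star (hf (measurableSet_singleton (f ω))) h).mp rfl).symm

/-- A finite stopping time of the raw filtration does not see the path after stopping. -/
theorem stoppingTime_stopPath {τ : PathSpace d → ℝ≥0} (hτ : IsRawStoppingTime τ)
    (ω : PathSpace d) : τ (stopPath (τ ω) ω) = τ ω := by
  have hle : ∀ t, MeasurableSet[rawFiltration d t] {ω | τ ω ≤ t} := fun t => by
    simpa only [WithTop.coe_le_coe] using hτ t
  have hag : ∀ s ≤ τ ω, ∀ u ≤ s, stopPath (τ ω) ω u = ω u := fun s hs u hu => by
    rw [stopPath_apply, min_eq_left (hu.trans hs)]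
  have h1 : τ (stopPath (τ ω) ω) ≤ τ ω :=
    (mem_iff_of_agree (hle (τ ω)) (hag _ le_rfl)).mpr (le_refl (τ ω))
  exact le_antisymm h1
    ((mem_iff_of_agree (hle (τ (stopPath (τ ω) ω))) (hag _ h1)).mp (le_refl (τ _)))

theorem measurable_stopPath {τ : PathSpace d → ℝ≥0} (hτ : IsRawStoppingTime τ) :
    Measurable[rawSigma hτ] (fun ω => stopPath (τ ω) ω) := by
  refine @PathSpace.measurable_of_eval d _ (rawSigma hτ) _ fun u => ?_
  have hmin : IsStoppingTime (rawFiltration d) (fun ω => min (τ ω : WithTop ℝ≥0) u) :=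
    IsStoppingTime.min hτ (isStoppingTime_const _ u)
  have hprog : IsStronglyProgressive (rawFiltration d) (fun u (ω : PathSpace d) => ω u) :=
    StronglyAdapted.isStronglyProgressive_of_continuous
      (fun u => (measurable_eval_rawFiltration le_rfl).stronglyMeasurable)
      (fun ω => ω.1.continuous)
  have h1 := measurable_stoppedValue hprog hmin
  have h2 := h1.mono (IsStoppingTime.measurableSpace_mono hmin hτ fun ω => min_le_left _ _) le_rfl
  convert h2 using 2 with ω
  rw [stopPath_apply, stoppedValue]
  have : min (τ ω : WithTop ℝ≥0) u = ((min u (τ ω) : ℝ≥0) : WithTop ℝ≥0) := by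
    rw [min_comm, WithTop.coe_min]
  rw [this, WithTop.untopA_eq_untop WithTop.coe_ne_top, WithTop.untop_coe]

theorem rawSigma_le {τ : PathSpace d → ℝ≥0} (hτ : IsRawStoppingTime τ) :
    rawSigma hτ ≤ borel (PathSpace d) :=
  IsStoppingTime.measurableSpace_le hτ

theorem isRawStoppingTime_const (t : ℝ≥0) : IsRawStoppingTime (fun _ : PathSpace d => t) :=
  isStoppingTime_const _ t

theorem rawSigma_const (t : ℝ≥0) :
    rawSigma (isRawStoppingTime_const (d := d) t) = rawFiltration d t :=
  IsStoppingTime.measurableSpace_const _ t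

end Paths

/-! ### The extension to the universally measurable sets -/

section Extension

variable {d : ℕ}

/-- The `σ`-field of universally measurable subsets of path space. -/
abbrev univMeas (d : ℕ) : MeasurableSpace (PathSpace d) :=
  universalCompletion (borel (PathSpace d))

theorem borel_le_univMeas : borel (PathSpace d) ≤ univMeas d := le_universalCompletion _

theorem ae_ext_iff {Q : ProbabilityMeasure (PathSpace d)} {p : PathSpace d → Prop} :
    (∀ᵐ ω ∂(ext Q), p ω) ↔ ∀ᵐ ω ∂(Q : Measure (PathSpace d)), p ω := by
  rw [ae_iff, ae_iff, ext_apply]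

theorem rawFiltration_le_univMeas (t : ℝ≥0) : rawFiltration d t ≤ univMeas d :=
  ((rawFiltration d).le t).trans borel_le_univMeas

/-- Every event of a universal completion agrees almost surely with an event of the underlying
`σ`-field. -/
theorem exists_ae_eq_of_universalCompletion (Q : ProbabilityMeasure (PathSpace d))
    {m : MeasurableSpace (PathSpace d)} (hm : m ≤ univMeas d) {A : Set (PathSpace d)}
    (hA : MeasurableSet[universalCompletion m] A) :
    ∃ B, MeasurableSet[m] B ∧ A =ᵐ[ext Q] B := by
  have hP : @IsProbabilityMeasure _ m ((ext Q).trim hm) :=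
    @IsProbabilityMeasure.mk _ m _
      ((trim_measurableSet_eq hm MeasurableSet.univ).trans measure_univ)
  obtain ⟨B, hB, hAB⟩ := hA ((ext Q).trim hm) hP
  exact ⟨B, hB, ae_eq_of_ae_eq_trim hAB⟩

/-- A real function measurable for a universal completion is almost surely equal to a function
measurable for the underlying `σ`-field. -/
theorem exists_ae_eq_measurable {Ω : Type*} {m : MeasurableSpace Ω} {P : @Measure Ω m}
    (hP : @IsProbabilityMeasure Ω m P) {f : Ω → ℝ} (hf : Measurable[universalCompletion m] f) :
    ∃ g : Ω → ℝ, Measurable[m] g ∧ f =ᵐ[P] g := by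
  have h : NullMeasurable f P := fun s hs => hf hs P hP
  exact ⟨_, h.aemeasurable.measurable_mk, h.aemeasurable.ae_eq_mk⟩

theorem exists_ae_eq_measurable_ext (Q : ProbabilityMeasure (PathSpace d))
    {m : MeasurableSpace (PathSpace d)} (hm : m ≤ univMeas d) {f : PathSpace d → ℝ}
    (hf : Measurable[universalCompletion m] f) :
    ∃ g : PathSpace d → ℝ, Measurable[m] g ∧ f =ᵐ[ext Q] g := by
  have hP : @IsProbabilityMeasure _ m ((ext Q).trim hm) :=
    @IsProbabilityMeasure.mk _ m _
      ((trim_measurableSet_eq hm MeasurableSet.univ).trans measure_univ)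
  obtain ⟨g, hg, hfg⟩ := exists_ae_eq_measurable hP hf
  exact ⟨g, hg, ae_eq_of_ae_eq_trim hfg⟩

/-- Two measures that agree on a `σ`-field agree on its universal completion. -/
theorem ext_eq_of_universalCompletion {Q R : ProbabilityMeasure (PathSpace d)}
    {m : MeasurableSpace (PathSpace d)} (hm : m ≤ univMeas d)
    (h : ∀ A, MeasurableSet[m] A → ext R A = ext Q A) {A : Set (PathSpace d)}
    (hA : MeasurableSet[universalCompletion m] A) : ext R A = ext Q A := by
  have htrim : (ext R).trim hm = (ext Q).trim hm := by
    refine @Measure.ext _ m _ _ fun B hB => ?_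
    rw [trim_measurableSet_eq hm hB, trim_measurableSet_eq hm hB, h B hB]
  have hP : @IsProbabilityMeasure _ m ((ext Q).trim hm) :=
    @IsProbabilityMeasure.mk _ m _
      ((trim_measurableSet_eq hm MeasurableSet.univ).trans measure_univ)
  obtain ⟨B, hB, hAB⟩ := hA ((ext Q).trim hm) hP
  have h1 : A =ᵐ[ext Q] B := ae_eq_of_ae_eq_trim hAB
  have h2 : A =ᵐ[ext R] B := ae_eq_of_ae_eq_trim (by rw [htrim]; exact hAB)
  rw [measure_congr h1, measure_congr h2, h B hB]

/-- The value of a process at a stopping time is almost surely equal to an `F_τ`-measurable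
variable, if the process is adapted to the universal completions and its value at `τ` is
universally measurable: it is a universally measurable function of the path stopped at `τ`. -/
theorem exists_ae_eq_rawSigma_measurable {S : ℝ≥0 → PathSpace d → ℝ}
    (hS : ∀ t, Measurable[starFiltration d t] (S t)) {τ : PathSpace d → ℝ≥0}
    (hτ : IsRawStoppingTime τ) (hSτ : Measurable[univMeas d] fun ω => S (τ ω) ω)
    (Q : ProbabilityMeasure (PathSpace d)) :
    ∃ g : PathSpace d → ℝ, Measurable[rawSigma hτ] g ∧ (fun ω => S (τ ω) ω) =ᵐ[ext Q] g := by
  have hm := measurable_stopPath hτ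
  have hmB : Measurable (fun ω : PathSpace d => stopPath (τ ω) ω) := hm.mono (rawSigma_le hτ) le_rfl
  let P : Measure (PathSpace d) :=
    Measure.map (fun ω => stopPath (τ ω) ω) (Q : Measure (PathSpace d))
  have hP : IsProbabilityMeasure P := Measure.isProbabilityMeasure_map hmB.aemeasurable
  obtain ⟨g, hg, hfg⟩ := exists_ae_eq_measurable hP hSτ
  refine ⟨fun ω => g (stopPath (τ ω) ω), hg.comp hm, ?_⟩
  have h1 := ae_of_ae_map hmB.aemeasurable hfg
  refine ae_ext_iff.mpr (h1.mono fun ω hω => ?_)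
  change S (τ ω) ω = g (stopPath (τ ω) ω)
  rw [← hω]
  change _ = S (τ (stopPath (τ ω) ω)) _
  rw [stoppingTime_stopPath hτ]
  exact eq_of_agree_star (hS (τ ω)) fun u hu => by rw [stopPath_apply, min_eq_left hu]

end Extension

/-! ### Pasting two priors at a deterministic time -/

section Kernel

variable {Ω : Type*} {m : MeasurableSpace Ω} {mΩ : MeasurableSpace Ω} [StandardBorelSpace Ω]

theorem setLIntegral_trim_condExpKernel (μ : Measure Ω) [IsFiniteMeasure μ] (hm : m ≤ mΩ)
    {A B : Set Ω} (hA : MeasurableSet[m] A) (hB : MeasurableSet B) :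
    ∫⁻ ω in A, condExpKernel μ m ω B ∂(μ.trim hm) = μ (A ∩ B) := by
  rw [← Measure.compProd_apply_prod hA hB, compProd_trim_condExpKernel hm,
    Measure.map_apply (f := Function.diag) ((measurable_id'' hm).prodMk measurable_id)
      (hA.prod hB)]
  rfl

/-- The conditional distribution of the identity, joined with the conditioning point, is carried by
every measurable set containing the diagonal. -/
theorem condExpKernel_ae_of_diag (μ : Measure Ω) [IsFiniteMeasure μ] (hm : m ≤ mΩ)
    {D : Set (Ω × Ω)} (hD : MeasurableSet[m.prod mΩ] D) (hdiag : ∀ ω, (ω, ω) ∈ D) :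
    ∀ᵐ ω ∂(μ.trim hm), ∀ᵐ ω' ∂(condExpKernel μ m ω), (ω, ω') ∈ D := by
  have h1 : ∀ᵐ p ∂((μ.trim hm) ⊗ₘ condExpKernel μ m), p ∈ D := by
    rw [compProd_trim_condExpKernel]
    refine (Measure.map_apply (f := Function.diag) ((measurable_id'' hm).prodMk measurable_id)
      hD.compl).trans ?_
    rw [show Function.diag ⁻¹' Dᶜ = ∅ from Set.eq_empty_of_forall_notMem fun ω h => h (hdiag ω),
      measure_empty]
  exact Measure.ae_ae_of_ae_compProd h1

end Kernel

section Pasting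

variable {d : ℕ}

theorem rawSigma_eq_of_eq_const {θ : PathSpace d → ℝ≥0} (hθ : IsRawStoppingTime θ) {t : ℝ≥0}
    (h : ∀ ω, θ ω = t) : rawSigma hθ = rawFiltration d t := by
  obtain rfl : θ = fun _ => t := funext h
  exact rawSigma_const t

theorem measurable_concat (t : ℝ≥0) (ω : PathSpace d) : Measurable (concat t ω) := by
  refine PathSpace.measurable_of_eval fun u => ?_
  exact (measurable_const.add (continuous_eval (u - t)).measurable :
    Measurable fun ω' : PathSpace d => ω (min u t) + ω' (u - t))

/-- The regular conditional distribution given `F_t` is carried by the paths that agree with the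
conditioning path on `[0, t]`. -/
theorem condExpKernel_ae_agree (R : ProbabilityMeasure (PathSpace d)) (t : ℝ≥0) :
    ∀ᵐ ω ∂((R : Measure (PathSpace d)).trim ((rawFiltration d).le t)),
      ∀ᵐ ω' ∂(condExpKernel (R : Measure (PathSpace d)) (rawFiltration d t) ω),
        ∀ u ≤ t, ω u = ω' u := by
  let D : Set (PathSpace d × PathSpace d) :=
    {p | ∀ n, p.1 (min (TopologicalSpace.denseSeq ℝ≥0 n) t)
      = p.2 (min (TopologicalSpace.denseSeq ℝ≥0 n) t)}
  have hD : MeasurableSet[(rawFiltration d t : MeasurableSpace (PathSpace d)).prod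
      (borel (PathSpace d))] D := by
    simp only [D, Set.ofPred_forall]
    refine MeasurableSet.iInter fun n => ?_
    refine @measurableSet_eq_fun _ _
      ((rawFiltration d t : MeasurableSpace (PathSpace d)).prod (borel (PathSpace d))) _ _ _ _ ?_ ?_
    · exact (measurable_eval_rawFiltration (min_le_right _ _)).comp
        (@measurable_fst _ _ (rawFiltration d t) (borel (PathSpace d)))
    · exact (continuous_eval _).measurable.comp
        (@measurable_snd _ _ (rawFiltration d t) (borel (PathSpace d)))
  refine (condExpKernel_ae_of_diag (R : Measure (PathSpace d)) ((rawFiltration d).le t) hD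
    fun ω n => rfl).mono fun ω hω => hω.mono fun ω' hω' => ?_
  have h2 : (fun v => ω (min v t)) = fun v => ω' (min v t) :=
    Continuous.ext_on (TopologicalSpace.denseRange_denseSeq ℝ≥0)
      (ω.1.continuous.comp (by fun_prop)) (ω'.1.continuous.comp (by fun_prop))
      (by rintro _ ⟨n, rfl⟩; exact hω' n)
  intro u hu
  simpa [min_eq_left hu] using congrFun h2 u

theorem condExpKernel_eq_of_agree (R : ProbabilityMeasure (PathSpace d)) {t : ℝ≥0}
    {ω ω' : PathSpace d} (h : ∀ u ≤ t, ω u = ω' u) :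
    condExpKernel (R : Measure (PathSpace d)) (rawFiltration d t) ω
      = condExpKernel (R : Measure (PathSpace d)) (rawFiltration d t) ω' := by
  refine Measure.ext fun B hB => ?_
  have h1 := measurable_condExpKernel (μ := (R : Measure (PathSpace d)))
    (m := rawFiltration d t) hB
  exact ((mem_iff_of_agree (h1 (measurableSet_singleton
    (condExpKernel (R : Measure (PathSpace d)) (rawFiltration d t) ω B))) h).mp rfl).symm

variable {𝒬 : ℝ≥0 → PathSpace d → Set (ProbabilityMeasure (PathSpace d))}

/-- The law of the increments after `t` under the conditional distribution given `F_t`. -/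
noncomputable def conditionalShift (R : ProbabilityMeasure (PathSpace d)) (t : ℝ≥0)
    (ω : PathSpace d) : ProbabilityMeasure (PathSpace d) :=
  ProbabilityMeasure.map
    (⟨condExpKernel (R : Measure (PathSpace d)) (rawFiltration d t) ω, inferInstance⟩ :
      ProbabilityMeasure (PathSpace d))
    (f := shift t) (continuous_shift t).measurable.aemeasurable

theorem conditionalShift_apply (R : ProbabilityMeasure (PathSpace d)) (t : ℝ≥0)
    (ω : PathSpace d) {B : Set (PathSpace d)} (hB : MeasurableSet B) :
    (conditionalShift R t ω : Measure (PathSpace d)) B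
      = condExpKernel (R : Measure (PathSpace d)) (rawFiltration d t) ω (shift t ⁻¹' B) :=
  Measure.map_apply (continuous_shift t).measurable hB

theorem shiftedConditional_eq_conditionalShift (R : ProbabilityMeasure (PathSpace d))
    {θ : PathSpace d → ℝ≥0} (hθ : IsRawStoppingTime θ) {t : ℝ≥0} (h : ∀ ω, θ ω = t)
    (ω : PathSpace d) : shiftedConditional R hθ ω = conditionalShift R t ω := by
  obtain rfl : θ = fun _ => t := funext h
  have h1 : rawSigma hθ = rawFiltration d t := rawSigma_const t
  refine Subtype.ext (Measure.ext fun B hB => ?_)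
  refine (Measure.map_apply (continuous_shift t).measurable hB).trans ?_
  refine Eq.trans ?_ (conditionalShift_apply R t ω hB).symm
  change condExpKernel (R : Measure (PathSpace d)) (rawSigma hθ) ω _ = _
  rw [h1]

/-- Conditional distributions of a prior `R` belong to the family almost surely under every measure
that agrees with `R` on `F_t`. No measurability of the exceptional set is needed: almost surely the
conditional distribution does not charge a Borel `R`-null set containing it, so some path outside
that null set agrees on `[0, t]` with the given one, and membership depends on the restriction to
`[0, t]` only. -/
theorem conditionalShift_mem (h𝒬 : IsStableFamily 𝒬) {P R : ProbabilityMeasure (PathSpace d)}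
    (hR : R ∈ priors 𝒬) {t : ℝ≥0}
    (hag : ∀ A, MeasurableSet[rawFiltration d t] A →
      (R : Measure (PathSpace d)) A = (P : Measure (PathSpace d)) A) :
    ∀ᵐ ω ∂(P : Measure (PathSpace d)), conditionalShift R t ω ∈ 𝒬 t ω := by
  have hm := (rawFiltration d).le t
  have h0 : ∀ᵐ ω ∂(R : Measure (PathSpace d)), conditionalShift R t ω ∈ 𝒬 t ω := by
    refine (h𝒬.invariance 0 (PathSpace.zero d) (fun _ => t) (isRawStoppingTime_const t)
      (fun _ => zero_le) R hR).mono fun ω hω => ?_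
    have h := shiftedConditional_eq_conditionalShift R
      (isRawStoppingTime_residualTime 0 (PathSpace.zero d) (isRawStoppingTime_const t))
      (t := t) (fun ω => tsub_zero t) ω
    rwa [h, concat_zero_time] at hω
  have htrim : (R : Measure (PathSpace d)).trim hm = (P : Measure (PathSpace d)).trim hm := by
    refine @Measure.ext _ (rawFiltration d t) _ _ fun A hA => ?_
    rw [trim_measurableSet_eq hm hA, trim_measurableSet_eq hm hA, hag A hA]
  have h1 : ∀ᵐ ω ∂((R : Measure (PathSpace d)).trim hm),
      ∀ᵐ ω' ∂(condExpKernel (R : Measure (PathSpace d)) (rawFiltration d t) ω),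
        conditionalShift R t ω' ∈ 𝒬 t ω' := by
    refine Measure.ae_ae_of_ae_comp ?_
    rwa [condExpKernel_comp_trim hm]
  have h2 := h1.and (condExpKernel_ae_agree R t)
  rw [htrim] at h2
  refine (ae_of_ae_trim hm h2).mono fun ω hω => ?_
  obtain ⟨ω', hω', hagree⟩ := (hω.1.and hω.2).exists
  have h3 : conditionalShift R t ω = conditionalShift R t ω' := by
    refine Subtype.ext (Measure.ext fun B hB => ?_)
    change (conditionalShift R t ω : Measure (PathSpace d)) B
      = (conditionalShift R t ω' : Measure (PathSpace d)) B
    rw [conditionalShift_apply R t ω hB, conditionalShift_apply R t ω' hB,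
      condExpKernel_eq_of_agree R hagree]
  rw [h3, h𝒬.nonanticipative t ω ω' hagree]
  exact hω'

/-- If `R` agrees with `P` on `F_t`, its conditional shifts paste back to `R` on events of `F_t`. -/
theorem setLIntegral_conditionalShift {P R : ProbabilityMeasure (PathSpace d)} {t : ℝ≥0}
    (hag : ∀ A, MeasurableSet[rawFiltration d t] A →
      (R : Measure (PathSpace d)) A = (P : Measure (PathSpace d)) A)
    {A B : Set (PathSpace d)} (hA : MeasurableSet[rawFiltration d t] A) (hB : MeasurableSet B) :
    ∫⁻ ω in A, (conditionalShift R t ω : Measure (PathSpace d)) {ω' | concat t ω ω' ∈ B}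
      ∂(P : Measure (PathSpace d)) = (R : Measure (PathSpace d)) (A ∩ B) := by
  have hm := (rawFiltration d).le t
  have htrim : (R : Measure (PathSpace d)).trim hm = (P : Measure (PathSpace d)).trim hm := by
    refine @Measure.ext _ (rawFiltration d t) _ _ fun A hA => ?_
    rw [trim_measurableSet_eq hm hA, trim_measurableSet_eq hm hA, hag A hA]
  have h1 := condExpKernel_ae_agree R t
  rw [htrim] at h1
  have h2 : ∀ᵐ ω ∂(P : Measure (PathSpace d)),
      (conditionalShift R t ω : Measure (PathSpace d)) {ω' | concat t ω ω' ∈ B}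
        = condExpKernel (R : Measure (PathSpace d)) (rawFiltration d t) ω B := by
    refine (ae_of_ae_trim hm h1).mono fun ω hω => ?_
    refine (conditionalShift_apply R t ω (measurable_concat t ω hB)).trans ?_
    refine measure_congr (hω.mono fun ω' hω' => ?_)
    change (concat t ω (shift t ω') ∈ B) = (ω' ∈ B)
    rw [concat_shift_of_agree hω']
  rw [setLIntegral_congr_fun_ae (hm _ hA) (h2.mono fun ω h _ => h),
    ← setLIntegral_trim_condExpKernel (R : Measure (PathSpace d)) hm hA hB, htrim,
    restrict_trim hm _ hA, lintegral_trim hm (measurable_condExpKernel hB)]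

/-- Stability under pasting: a prior `P` may be replaced by a prior `R` with the same restriction
to `F_t` on an event of `F_t`. -/
theorem exists_paste (h𝒬 : IsStableFamily 𝒬) {P R : ProbabilityMeasure (PathSpace d)}
    (hP : P ∈ priors 𝒬) (hR : R ∈ priors 𝒬) {t : ℝ≥0}
    (hag : ∀ A, MeasurableSet[rawFiltration d t] A →
      (R : Measure (PathSpace d)) A = (P : Measure (PathSpace d)) A)
    {A : Set (PathSpace d)} (hA : MeasurableSet[rawFiltration d t] A) :
    ∃ P' ∈ priors 𝒬, (P' : Measure (PathSpace d))
      = (R : Measure (PathSpace d)).restrict A + (P : Measure (PathSpace d)).restrict Aᶜ := by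
  classical
  have hm := (rawFiltration d).le t
  let μ : Measure (PathSpace d) :=
    (R : Measure (PathSpace d)).restrict A + (P : Measure (PathSpace d)).restrict Aᶜ
  have hμ : IsProbabilityMeasure μ := by
    constructor
    simp only [μ, Measure.add_apply, Measure.restrict_apply MeasurableSet.univ, Set.univ_inter]
    rw [hag A hA, measure_add_measure_compl (hm _ hA), measure_univ]
  let ν : PathSpace d → ProbabilityMeasure (PathSpace d) := fun ω =>
    if ω ∈ A then conditionalShift R t ω else conditionalShift P t ω
  have hres : ∀ ω : PathSpace d, residualTime 0 (PathSpace.zero d) (fun _ => t) ω = t :=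
    fun ω => tsub_zero t
  refine ⟨⟨μ, hμ⟩, ?_, rfl⟩
  refine h𝒬.pasting 0 (PathSpace.zero d) (fun _ => t) (isRawStoppingTime_const t)
    (fun _ => zero_le) P hP ν ?_ ?_ ⟨μ, hμ⟩ ?_
  · intro B hB
    rw [rawSigma_eq_of_eq_const _ hres]
    have h1 : (fun ω => (ν ω : Measure (PathSpace d)) B) = fun ω =>
        if ω ∈ A
        then condExpKernel (R : Measure (PathSpace d)) (rawFiltration d t) ω (shift t ⁻¹' B)
        else condExpKernel (P : Measure (PathSpace d)) (rawFiltration d t) ω (shift t ⁻¹' B) := by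
      funext ω
      by_cases h : ω ∈ A
      · simp only [ν, if_pos h]; exact conditionalShift_apply R t ω hB
      · simp only [ν, if_neg h]; exact conditionalShift_apply P t ω hB
    rw [h1]
    have hB' := (continuous_shift (d := d) t).measurable hB
    have hR' : Measurable[rawFiltration d t] fun ω =>
        condExpKernel (R : Measure (PathSpace d)) (rawFiltration d t) ω (shift t ⁻¹' B) :=
      measurable_condExpKernel hB'
    have hP' : Measurable[rawFiltration d t] fun ω =>
        condExpKernel (P : Measure (PathSpace d)) (rawFiltration d t) ω (shift t ⁻¹' B) :=
      measurable_condExpKernel hB'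
    exact Measurable.ite hA hR' hP'
  · filter_upwards [conditionalShift_mem h𝒬 hR hag,
      conditionalShift_mem h𝒬 hP (fun A _ => rfl)] with ω h1 h2
    rw [concat_zero_time]
    by_cases h : ω ∈ A
    · simpa only [ν, if_pos h] using h1
    · simpa only [ν, if_neg h] using h2
  · intro B hB
    have hAm : MeasurableSet A := hm _ hA
    simp only [hres]
    rw [← lintegral_add_compl _ hAm]
    have e1 : ∫⁻ ω in A, (ν ω : Measure (PathSpace d)) {ω' | concat t ω ω' ∈ B}
        ∂(P : Measure (PathSpace d)) = (R : Measure (PathSpace d)) (A ∩ B) := by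
      rw [← setLIntegral_conditionalShift hag hA hB]
      exact setLIntegral_congr_fun hAm fun ω h => by simp only [ν, if_pos h]
    have e2 : ∫⁻ ω in Aᶜ, (ν ω : Measure (PathSpace d)) {ω' | concat t ω ω' ∈ B}
        ∂(P : Measure (PathSpace d)) = (P : Measure (PathSpace d)) (Aᶜ ∩ B) := by
      rw [← setLIntegral_conditionalShift (P := P) (fun A _ => rfl) hA.compl hB]
      exact setLIntegral_congr_fun hAm.compl fun ω h => by
        simp only [ν, if_neg (show ω ∉ A from h)]
    rw [e1, e2]
    change μ B = _
    simp only [μ, Measure.add_apply, Measure.restrict_apply hB, Set.inter_comm B]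

end Pasting

/-! ### Optional stopping at countably valued stopping times -/

section CountableStopping

variable {Ω : Type*} {mΩ : MeasurableSpace Ω} {μ : Measure Ω} [IsFiniteMeasure μ]
  {𝓕 : Filtration ℝ≥0 mΩ} {X : ℝ≥0 → Ω → ℝ}

/-- A submartingale stopped at the single time `v` on an event `B ∈ F_v` is a submartingale. -/
theorem submartingale_stop_on_event (hX : Submartingale X 𝓕 μ) (v : ℝ≥0) {B : Set Ω}
    (hB : MeasurableSet[𝓕 v] B) [DecidablePred (· ∈ B)] :
    Submartingale (fun t ω => if v ≤ t ∧ ω ∈ B then X v ω else X t ω) 𝓕 μ := by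
  have hBm : MeasurableSet B := 𝓕.le v _ hB
  have hlt : ∀ t, t < v → (fun ω => if v ≤ t ∧ ω ∈ B then X v ω else X t ω) = X t :=
    fun t ht => funext fun ω => if_neg fun h => absurd h.1 (not_le.mpr ht)
  have hge : ∀ t, v ≤ t → (fun ω => if v ≤ t ∧ ω ∈ B then X v ω else X t ω)
      = B.piecewise (X v) (X t) := fun t ht => funext fun ω => by
    simp only [ht, true_and, Set.piecewise]
  have hint : ∀ t, Integrable (fun ω => if v ≤ t ∧ ω ∈ B then X v ω else X t ω) μ := by
    intro t
    rcases lt_or_ge t v with ht | ht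
    · rw [hlt t ht]; exact hX.integrable t
    · rw [hge t ht]
      exact Integrable.piecewise hBm (hX.integrable v).integrableOn (hX.integrable t).integrableOn
  have hsplit : ∀ t, v ≤ t → ∀ A, MeasurableSet A →
      ∫ ω in A, (if v ≤ t ∧ ω ∈ B then X v ω else X t ω) ∂μ
        = ∫ ω in A ∩ B, X v ω ∂μ + ∫ ω in A ∩ Bᶜ, X t ω ∂μ := by
    intro t ht A hA
    rw [← integral_inter_add_sdiff hBm (hint t).integrableOn]
    congr 1
    · refine setIntegral_congr_fun (hA.inter hBm) fun ω hω => ?_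
      simp [ht, hω.2]
    · refine setIntegral_congr_fun (hA.diff hBm) fun ω hω => ?_
      simp [hω.2]
  refine submartingale_of_setIntegral_le ?_ hint ?_
  · intro t
    rcases lt_or_ge t v with ht | ht
    · change StronglyMeasurable[𝓕 t] (fun ω => if v ≤ t ∧ ω ∈ B then X v ω else X t ω)
      rw [hlt t ht]; exact hX.stronglyAdapted t
    · change StronglyMeasurable[𝓕 t] (fun ω => if v ≤ t ∧ ω ∈ B then X v ω else X t ω)
      rw [hge t ht]
      exact ((hX.stronglyAdapted v).mono (𝓕.mono ht)).piecewise (𝓕.mono ht _ hB)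
        (hX.stronglyAdapted t)
  · intro s t hst A hA
    have hAm : MeasurableSet A := 𝓕.le s _ hA
    rcases lt_or_ge t v with ht | ht
    · have h1 := hlt s (hst.trans_lt ht)
      have h2 := hlt t ht
      simp only [h1, h2]
      exact hX.setIntegral_le hst hA
    · rw [hsplit t ht A hAm]
      rcases lt_or_ge s v with hs | hs
      · have h1 := hlt s hs
        simp only [h1]
        have hAv : MeasurableSet[𝓕 v] A := 𝓕.mono hs.le _ hA
        calc ∫ ω in A, X s ω ∂μ ≤ ∫ ω in A, X v ω ∂μ := hX.setIntegral_le hs.le hA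
          _ = ∫ ω in A ∩ B, X v ω ∂μ + ∫ ω in A ∩ Bᶜ, X v ω ∂μ := by
            rw [← Set.sdiff_eq, integral_inter_add_sdiff hBm (hX.integrable v).integrableOn]
          _ ≤ _ := by
            gcongr 1
            exact hX.setIntegral_le ht (hAv.inter hB.compl)
      · rw [hsplit s hs A hAm]
        gcongr 1
        exact hX.setIntegral_le hst (hA.inter (𝓕.mono hs _ hB).compl)

open scoped Classical in
/-- Stopping at the first `K` values of a stopping time only. -/
theorem submartingale_stop_finite (hX : Submartingale X 𝓕 μ) {τ : Ω → WithTop ℝ≥0}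
    (hτ : IsStoppingTime 𝓕 τ) (v : ℕ → ℝ≥0) (K : ℕ) :
    Submartingale (fun t ω => if ∃ i < K, τ ω = v i then stoppedProcess X τ t ω else X t ω)
      𝓕 μ := by
  induction K with
  | zero => simpa using hX
  | succ K ih =>
    have h := submartingale_stop_on_event ih (v K) (hτ.measurableSet_eq (v K))
    convert h using 3 with t ω
    simp only [Set.mem_ofPred_eq]
    by_cases hK : τ ω = v K
    · have hval : ∀ t, stoppedProcess X τ t ω = X (min t (v K)) ω := fun t => by
        rw [stoppedProcess, hK, ← WithTop.coe_min, WithTop.untopA_eq_untop WithTop.coe_ne_top,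
          WithTop.untop_coe]
      rw [if_pos ⟨K, K.lt_succ_self, hK⟩, hval, hval, min_self, ite_self]
      split_ifs with h1 h2
      · rw [min_eq_right h1.1]
      · rfl
      · rw [min_eq_left]
        exact le_of_not_ge fun h => h1 ⟨h, hK⟩
    · rw [if_neg (show ¬ (v K ≤ t ∧ τ ω = v K) from fun h => hK h.2)]
      refine if_congr ⟨?_, ?_⟩ rfl rfl
      · rintro ⟨i, hi, h⟩
        rcases Nat.lt_succ_iff_lt_or_eq.mp hi with h' | h'
        · exact ⟨i, h', h⟩
        · exact absurd (h' ▸ h) hK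
      · rintro ⟨i, hi, h⟩
        exact ⟨i, hi.trans K.lt_succ_self, h⟩

/-- Optional stopping for a submartingale without path regularity: a stopping time with countably
many values may be used as soon as the stopped variables are integrable. -/
theorem Submartingale.stoppedProcess_of_countable (hX : Submartingale X 𝓕 μ)
    {τ : Ω → WithTop ℝ≥0} (hτ : IsStoppingTime 𝓕 τ) (v : ℕ → ℝ≥0)
    (hv : ∀ ω, τ ω = ⊤ ∨ ∃ i, τ ω = v i) (hint : ∀ t, Integrable (stoppedProcess X τ t) μ) :
    Submartingale (stoppedProcess X τ) 𝓕 μ := by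
  classical
  let Z : ℕ → ℝ≥0 → Ω → ℝ := fun K t ω =>
    if ∃ i < K, τ ω = v i then stoppedProcess X τ t ω else X t ω
  have hZ : ∀ K, Submartingale (Z K) 𝓕 μ := submartingale_stop_finite hX hτ v
  have hlim : ∀ t ω, ∀ᶠ K in atTop, Z K t ω = stoppedProcess X τ t ω := by
    intro t ω
    rcases hv ω with h | ⟨i, h⟩
    · refine Eventually.of_forall fun K => ?_
      have : stoppedProcess X τ t ω = X t ω := stoppedProcess_eq_of_le (by rw [h]; exact le_top)
      simp only [Z, this, ite_self]
    · filter_upwards [eventually_gt_atTop i] with K hK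
      exact if_pos ⟨i, hK, h⟩
  have hlim' : ∀ t ω, Tendsto (fun K => Z K t ω) atTop (𝓝 (stoppedProcess X τ t ω)) :=
    fun t ω => tendsto_const_nhds.congr' ((hlim t ω).mono fun K h => h.symm)
  have hset : ∀ t A, Tendsto (fun K => ∫ ω in A, Z K t ω ∂μ) atTop
      (𝓝 (∫ ω in A, stoppedProcess X τ t ω ∂μ)) := by
    intro t A
    refine tendsto_integral_of_dominated_convergence
      (fun ω => |(stoppedProcess X τ t ω)| + |X t ω|)
      (fun K => ((hZ K).integrable t).aestronglyMeasurable.restrict)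
      ((hint t).abs.add (hX.integrable t).abs).restrict ?_ (Eventually.of_forall (hlim' t))
    refine fun K => Eventually.of_forall fun ω => ?_
    simp only [Z, Real.norm_eq_abs]
    split_ifs
    · exact le_add_of_nonneg_right (abs_nonneg _)
    · exact le_add_of_nonneg_left (abs_nonneg _)
  refine submartingale_of_setIntegral_le (fun t => ?_) hint fun s t hst A hA => ?_
  · exact @stronglyMeasurable_of_tendsto _ _ _ (𝓕 t) _ _ _ _ _ _ _
      (fun K => (hZ K).stronglyAdapted t) (tendsto_pi_nhds.mpr (hlim' t))
  · exact le_of_tendsto_of_tendsto' (hset s A) (hset t A) fun K => (hZ K).setIntegral_le hst hA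

end CountableStopping

/-! ### Countably valued localizing times of a continuous process -/

section Localizing

variable {Ω : Type*} {mΩ : MeasurableSpace Ω} {μ : Measure Ω}
  {𝓕 : Filtration ℝ≥0 mΩ} {X : ℝ≥0 → Ω → ℝ}

/-- The event that `X` exceeds the level `a` at some time in `[0, t]`. -/
def exceedSet (X : ℝ≥0 → Ω → ℝ) (t : ℝ≥0) (a : ℝ) : Set Ω := {ω | ∃ u ≤ t, a < X u ω}

theorem exceedSet_mono {s t : ℝ≥0} (hst : s ≤ t) {a b : ℝ} (hab : a ≤ b) :
    exceedSet X s b ⊆ exceedSet X t a := by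
  rintro ω ⟨u, hu, h⟩
  exact ⟨u, hu.trans hst, hab.trans_lt h⟩

/-- By right-continuity, only countably many times before `t`, and `t` itself, matter. -/
theorem measurableSet_exceedSet (hX : ∀ t, Measurable[𝓕 t] (X t))
    (hr : ∀ ω t, ContinuousWithinAt (fun u => X u ω) (Set.Ici t) t) (t : ℝ≥0) (a : ℝ) :
    MeasurableSet[𝓕 t] (exceedSet X t a) := by
  have h : exceedSet X t a = {ω | a < X t ω} ∪
      ⋃ n, {ω | TopologicalSpace.denseSeq ℝ≥0 n ≤ t ∧
        a < X (TopologicalSpace.denseSeq ℝ≥0 n) ω} := by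
    ext ω
    simp only [exceedSet, Set.mem_union, Set.mem_iUnion, Set.mem_ofPred_eq]
    constructor
    · rintro ⟨u, hu, hlt⟩
      rcases hu.eq_or_lt with rfl | hu'
      · exact Or.inl hlt
      · right
        have h1 : {x | a < X x ω} ∈ 𝓝[≥] u := (hr ω u).eventually_const_lt hlt
        obtain ⟨c, hc, hsub⟩ := mem_nhdsGE_iff_exists_Ico_subset.mp h1
        obtain ⟨n, hn⟩ := (TopologicalSpace.denseRange_denseSeq ℝ≥0).exists_mem_open
          (isOpen_Ioo (a := u) (b := min c t)) (Set.nonempty_Ioo.mpr (lt_min hc hu'))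
        exact ⟨n, (hn.2.trans_le (min_le_right _ _)).le,
          hsub ⟨hn.1.le, hn.2.trans_le (min_le_left _ _)⟩⟩
    · rintro (h | ⟨n, hn, h⟩)
      · exact ⟨t, le_rfl, h⟩
      · exact ⟨_, hn, h⟩
  rw [h]
  refine MeasurableSet.union (measurableSet_lt measurable_const (hX t))
    (MeasurableSet.iUnion fun n => ?_)
  by_cases hn : TopologicalSpace.denseSeq ℝ≥0 n ≤ t
  · simp only [hn, true_and]
    exact 𝓕.mono hn _ (measurableSet_lt measurable_const (hX _))
  · simp only [hn, false_and, Set.ofPred_false]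
    exact @MeasurableSet.empty _ (𝓕 t)

/-- The event that, on the grid of mesh `h`, the process exceeds the level `a'` before the end of
some mesh interval at whose beginning it has not yet exceeded `a`. -/
def overshootSet (X : ℝ≥0 → Ω → ℝ) (h : ℝ≥0) (a a' : ℝ) : Set Ω :=
  ⋃ j : ℕ, exceedSet X ((j + 1) * h) a' \ exceedSet X (j * h) a

/-- Overshoots between two levels become improbable as the mesh tends to zero. -/
theorem exists_mesh [IsFiniteMeasure μ] (hX : ∀ t, Measurable[𝓕 t] (X t))
    (hr : ∀ ω t, ContinuousWithinAt (fun u => X u ω) (Set.Ici t) t)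
    (hc : ∀ᵐ ω ∂μ, UniformContinuous fun u => X u ω) {a a' : ℝ} (haa : a < a')
    {ε : ℝ≥0∞} (hε : 0 < ε) : ∃ h : ℝ≥0, 0 < h ∧ μ (overshootSet X h a a') ≤ ε := by
  let h : ℕ → ℝ≥0 := fun n => 1 / ((n : ℝ≥0) + 1)
  have hmeas : ∀ t b, MeasurableSet (exceedSet X t b) := fun t b =>
    𝓕.le t _ (measurableSet_exceedSet hX hr t b)
  have hlim : Tendsto (fun n => μ (overshootSet X (h n) a a')) atTop (𝓝 (μ ∅)) := by
    refine tendsto_measure_of_ae_tendsto_indicator_of_isFiniteMeasure atTop MeasurableSet.empty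
      (fun n => MeasurableSet.iUnion fun j => (hmeas _ _).diff (hmeas _ _)) ?_
    filter_upwards [hc] with ω hω
    obtain ⟨δ, hδ, hd⟩ := Metric.uniformContinuous_iff.mp hω (a' - a) (sub_pos.mpr haa)
    have h0 : Tendsto (fun n : ℕ => (1 : ℝ) / ((n : ℝ) + 1)) atTop (𝓝 0) :=
      tendsto_one_div_add_atTop_nhds_zero_nat
    filter_upwards [h0.eventually_lt_const hδ] with n hn
    simp only [Set.mem_empty_iff_false, iff_false]
    intro hmem
    obtain ⟨j, ⟨u, hu, hua⟩, hnot⟩ := Set.mem_iUnion.mp hmem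
    have hj : X (j * h n) ω ≤ a := by
      by_contra hcon
      exact hnot ⟨_, le_rfl, not_le.mp hcon⟩
    have hju : j * h n < u := by
      by_contra hcon
      exact hnot ⟨u, not_lt.mp hcon, haa.trans hua⟩
    have hdist : dist u (j * h n) < δ := by
      rw [NNReal.dist_eq, abs_of_nonneg (sub_nonneg.mpr (by exact_mod_cast hju.le))]
      have h1 : (u : ℝ) ≤ ((j : ℝ) + 1) * (h n : ℝ) := by exact_mod_cast hu
      have h2 : ((h n : ℝ≥0) : ℝ) = 1 / ((n : ℝ) + 1) := by simp [h]
      push_cast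
      rw [h2] at h1 ⊢
      linarith
    have h3 := hd hdist
    rw [Real.dist_eq] at h3
    have h4 := le_abs_self (X u ω - X (j * h n) ω)
    linarith
  rw [measure_empty] at hlim
  obtain ⟨n, hn⟩ := (hlim.eventually_le_const hε).exists
  exact ⟨h n, by positivity, hn⟩

/-- A stopping time with countably many values that stops a continuous process between its first
passages above the levels `b` and `b + 1`. Rounding the first passage above `b` up to a grid would
let the process overshoot; instead one tries levels `a 0 < a 1 < ⋯` in `[b, b + 1)` in turn, the
first passage above `a k` being rounded up to a grid so fine that the process exceeds `a (k + 1)`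
by then with probability at most `2⁻ᵏ` only, and stops at the first attempt without overshoot. -/
theorem exists_countable_passage_time [IsFiniteMeasure μ] (hX : ∀ t, Measurable[𝓕 t] (X t))
    (hr : ∀ ω t, ContinuousWithinAt (fun u => X u ω) (Set.Ici t) t)
    (hc : ∀ᵐ ω ∂μ, UniformContinuous fun u => X u ω) {b : ℝ} (hb : ∀ ω, X 0 ω ≤ b) :
    ∃ τ : Ω → WithTop ℝ≥0, IsStoppingTime 𝓕 τ ∧
      (∃ v : ℕ → ℝ≥0, ∀ ω, τ ω = ⊤ ∨ ∃ i, τ ω = v i) ∧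
      (∀ᵐ ω ∂μ, ∀ u : ℝ≥0, (u : WithTop ℝ≥0) ≤ τ ω → X u ω ≤ b + 1) ∧
      (∀ ω, τ ω ≠ ⊤ → ∃ u : ℝ≥0, (u : WithTop ℝ≥0) ≤ τ ω ∧ b < X u ω) ∧ ∀ ω, 0 < τ ω := by
  let a : ℕ → ℝ := fun k => b + (1 - (1 / 2) ^ k)
  have ha : StrictMono a := fun i j hij => by
    have : (1 / 2 : ℝ) ^ j < (1 / 2) ^ i :=
      pow_lt_pow_right_of_lt_one₀ (by norm_num) (by norm_num) hij
    simp only [a]; linarith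
  have hab : ∀ k, b ≤ a k := fun k => by
    have : (1 / 2 : ℝ) ^ k ≤ 1 := pow_le_one₀ (by norm_num) (by norm_num)
    simp only [a]; linarith
  have hab' : ∀ k, a k ≤ b + 1 := fun k => by
    have : (0 : ℝ) ≤ (1 / 2) ^ k := by positivity
    simp only [a]; linarith
  have hmesh : ∀ k : ℕ, ∃ h : ℝ≥0, 0 < h ∧
      μ (overshootSet X h (a k) (a (k + 1))) ≤ (1 / 2 : ℝ≥0∞) ^ k := fun k =>
    exists_mesh hX hr hc (ha k.lt_succ_self) (ENNReal.pow_pos (by norm_num) k)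
  choose h hpos hsmall using hmesh
  let v : ℕ × ℕ → ℝ≥0 := fun p => (p.2 + 1) * h p.1
  -- On `E (k, j)` the first passage above `a k` occurs in the `j`-th mesh interval of the `k`-th
  -- grid, and `a (k + 1)` is not exceeded by the end `v (k, j)` of that interval.
  let E : ℕ × ℕ → Set Ω := fun p => (exceedSet X (v p) (a p.1) \ exceedSet X (p.2 * h p.1) (a p.1))
    \ exceedSet X (v p) (a (p.1 + 1))
  have hle : ∀ p : ℕ × ℕ, p.2 * h p.1 ≤ v p := fun p => by
    simp only [v]; gcongr; exact le_self_add
  have hE : ∀ p, MeasurableSet[𝓕 (v p)] (E p) := fun p =>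
    ((measurableSet_exceedSet hX hr _ _).diff
      (𝓕.mono (hle p) _ (measurableSet_exceedSet hX hr _ _))).diff
      (measurableSet_exceedSet hX hr _ _)
  -- The attempts succeed in order: `ω ∈ E (k, j)` implies that `a (k + 1)`, hence any higher
  -- level, is passed only after `v (k, j)`, so the smallest successful `k` gives the smallest time.
  have hmin : ∀ ω, (∃ p, ω ∈ E p) → ∃ p, ω ∈ E p ∧ ∀ p', ω ∈ E p' → v p ≤ v p' := by
    classical
    rintro ω ⟨⟨k, j⟩, hp⟩
    have hex : ∃ k j, ω ∈ E (k, j) := ⟨k, j, hp⟩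
    obtain ⟨j₀, hj₀⟩ := Nat.find_spec hex
    refine ⟨(Nat.find hex, j₀), hj₀, ?_⟩
    rintro ⟨k', j'⟩ hp'
    rcases (Nat.find_min' hex ⟨j', hp'⟩).eq_or_lt with heq | hlt
    · rw [heq] at hj₀ ⊢
      by_contra hcon
      have hjj : j' < j₀ := by
        by_contra hcon2
        refine hcon ?_
        simp only [v]
        gcongr
        exact not_lt.mp hcon2
      refine hj₀.1.2 (exceedSet_mono ?_ le_rfl hp'.1.1)
      simp only [v]
      gcongr
      exact_mod_cast hjj
    · by_contra hcon
      exact hj₀.2 (exceedSet_mono (not_le.mp hcon).le (ha.monotone hlt) hp'.1.1)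
  have hτ : ∀ ω, ∃ x : WithTop ℝ≥0, (x = ⊤ ∧ ∀ p, ω ∉ E p) ∨
      ∃ p, x = v p ∧ ω ∈ E p ∧ ∀ p', ω ∈ E p' → v p ≤ v p' := by
    intro ω
    by_cases hω : ∃ p, ω ∈ E p
    · obtain ⟨p, h1, h2⟩ := hmin ω hω
      exact ⟨v p, Or.inr ⟨p, rfl, h1, h2⟩⟩
    · exact ⟨⊤, Or.inl ⟨rfl, fun p hp => hω ⟨p, hp⟩⟩⟩
  choose τ hτ using hτ
  -- `τ` is the least `v p` with `ω ∈ E p`, and hence a stopping time as `E p ∈ F_{v p}`.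
  refine ⟨τ, ?_, ⟨fun n => v (Denumerable.ofNat (ℕ × ℕ) n), ?_⟩, ?_, ?_, ?_⟩
  · intro t
    have hset : {ω | τ ω ≤ t} = ⋃ p : ℕ × ℕ, {ω | v p ≤ t ∧ ω ∈ E p} := by
      ext ω
      simp only [Set.mem_ofPred_eq, Set.mem_iUnion]
      rcases hτ ω with ⟨h1, h2⟩ | ⟨p, h1, h2, h3⟩
      · simp only [h1, top_le_iff, WithTop.coe_ne_top, false_iff, not_exists]
        exact fun p hp => h2 p hp.2
      · rw [h1, WithTop.coe_le_coe]
        exact ⟨fun h => ⟨p, h, h2⟩, fun ⟨p', h, h'⟩ => (h3 p' h').trans h⟩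
    rw [hset]
    refine MeasurableSet.iUnion fun p => ?_
    by_cases hp : v p ≤ t
    · simp only [hp, true_and, Set.ofPred_mem_eq]
      exact 𝓕.mono hp _ (hE p)
    · simp only [hp, false_and, Set.ofPred_false]
      exact @MeasurableSet.empty _ (𝓕 t)
  · intro ω
    rcases hτ ω with ⟨h1, -⟩ | ⟨p, h1, -⟩
    · exact Or.inl h1
    · exact Or.inr ⟨Encodable.encode p, by rw [h1]; simp only [Denumerable.ofNat_encode]⟩
  · have hnull : μ (⋂ k, overshootSet X (h k) (a k) (a (k + 1))) = 0 := by
      refine le_antisymm (ge_of_tendsto' (ENNReal.tendsto_pow_atTop_nhds_zero_of_lt_one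
        (r := 1 / 2) (by norm_num)) fun k => ?_) zero_le
      exact (measure_mono (Set.iInter_subset _ k)).trans (hsmall k)
    filter_upwards [measure_eq_zero_iff_ae_notMem.mp hnull] with ω hω u hu
    rcases hτ ω with ⟨-, h2⟩ | ⟨p, h1, h2, -⟩
    -- If no attempt succeeds, some `k` without overshoot shows that `a k` is never exceeded.
    · obtain ⟨k, hk⟩ := not_forall.mp fun hall => hω (Set.mem_iInter.mpr hall)
      by_contra hcon
      have hex : ∃ j : ℕ, ω ∈ exceedSet X (j * h k) (a k) := by
        obtain ⟨j, hj⟩ := exists_nat_ge (u / h k)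
        exact ⟨j, u, (div_le_iff₀ (hpos k)).mp hj, (hab' k).trans_lt (not_le.mp hcon)⟩
      classical
      have hspec := Nat.find_spec hex
      rcases hfind : Nat.find hex with _ | i
      · rw [hfind] at hspec
        obtain ⟨w, hw, hlt⟩ := hspec
        rw [Nat.cast_zero, zero_mul, nonpos_iff_eq_zero] at hw
        rw [hw] at hlt
        exact absurd (hb ω) (not_le.mpr ((hab k).trans_lt hlt))
      · rw [hfind] at hspec
        have hi : ω ∉ exceedSet X (i * h k) (a k) :=
          Nat.find_min hex (by rw [hfind]; exact i.lt_succ_self)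
        push_cast at hspec
        exact h2 (k, i) ⟨⟨hspec, hi⟩, fun h' => hk (Set.mem_iUnion.mpr ⟨i, h', hi⟩)⟩
    · rw [h1, WithTop.coe_le_coe] at hu
      by_contra hcon
      exact h2.2 ⟨u, hu, (hab' _).trans_lt (not_le.mp hcon)⟩
  · intro ω hω
    rcases hτ ω with ⟨h1, -⟩ | ⟨p, h1, h2, -⟩
    · exact absurd h1 hω
    · obtain ⟨u, hu, hlt⟩ := h2.1.1
      exact ⟨u, by rw [h1]; exact_mod_cast hu, (hab _).trans_lt hlt⟩
  · intro ω
    rcases hτ ω with ⟨h1, -⟩ | ⟨p, h1, -⟩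
    · rw [h1]; exact WithTop.top_pos
    · rw [h1, WithTop.coe_pos]
      have := hpos p.1
      simp only [v]
      positivity

end Localizing

/-! ### Local submartingales without path regularity -/

section LocalSubmartingale

variable {Ω : Type*} {mΩ : MeasurableSpace Ω} {μ : Measure Ω}
  {𝓕 : Filtration ℝ≥0 mΩ} {X Y : ℝ≥0 → Ω → ℝ}

theorem stoppedProcess_apply_coe {v : ℝ≥0} {τ : Ω → WithTop ℝ≥0} {ω : Ω} (h : τ ω = v) (t : ℝ≥0) :
    stoppedProcess X τ t ω = X (min t v) ω := by
  rw [stoppedProcess, h, ← WithTop.coe_min, WithTop.untopA_eq_untop WithTop.coe_ne_top,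
    WithTop.untop_coe]

/-- Every value of a stopped process is a value of the process at a time before the stopping
time. -/
theorem exists_stoppedProcess_eq (τ : Ω → WithTop ℝ≥0) (t : ℝ≥0) (ω : Ω) :
    ∃ u : ℝ≥0, u ≤ t ∧ (u : WithTop ℝ≥0) ≤ τ ω ∧ ∀ X : ℝ≥0 → Ω → ℝ,
      stoppedProcess X τ t ω = X u ω := by
  rcases h : τ ω with _ | v
  · exact ⟨t, le_rfl, le_top, fun X => stoppedProcess_eq_of_le (by rw [h]; exact le_top)⟩
  · exact ⟨min t v, min_le_left _ _, WithTop.coe_le_coe.mpr (min_le_right _ _),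
      fun X => stoppedProcess_apply_coe h t⟩

theorem stronglyAdapted_stoppedProcess_of_countable (hX : StronglyAdapted 𝓕 X)
    {τ : Ω → WithTop ℝ≥0} (hτ : IsStoppingTime 𝓕 τ) (v : ℕ → ℝ≥0)
    (hv : ∀ ω, τ ω = ⊤ ∨ ∃ i, τ ω = v i) : StronglyAdapted 𝓕 (stoppedProcess X τ) := by
  intro t
  suffices h : Measurable[𝓕 t] (stoppedProcess X τ t) from h.stronglyMeasurable
  intro s hs
  have hset : stoppedProcess X τ t ⁻¹' s =
      (⋃ i, {ω | v i ≤ t ∧ ω ∈ {ω | τ ω = v i} ∩ X (v i) ⁻¹' s}) ∪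
        ({ω | τ ω ≤ t}ᶜ ∩ X t ⁻¹' s) := by
    ext ω
    simp only [Set.mem_preimage, Set.mem_union, Set.mem_iUnion, Set.mem_ofPred_eq,
      Set.mem_inter_iff, Set.mem_compl_iff]
    rcases le_or_gt (τ ω) t with hle | hlt
    · rcases hv ω with h | ⟨i, h⟩
      · rw [h, top_le_iff] at hle
        exact absurd hle WithTop.coe_ne_top
      · have hi : v i ≤ t := by rw [h] at hle; exact_mod_cast hle
        rw [stoppedProcess_apply_coe h, min_eq_right hi]
        constructor
        · exact fun hmem => Or.inl ⟨i, hi, h, hmem⟩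
        · rintro (⟨j, -, hj, hmem⟩ | ⟨hn, -⟩)
          · rw [h, WithTop.coe_inj] at hj
            rwa [hj]
          · exact absurd hle hn
    · rw [stoppedProcess_eq_of_le hlt.le]
      constructor
      · exact fun hmem => Or.inr ⟨not_le.mpr hlt, hmem⟩
      · rintro (⟨j, hj, hj', -⟩ | ⟨-, hmem⟩)
        · rw [hj'] at hlt
          exact absurd hlt (not_lt.mpr (by exact_mod_cast hj))
        · exact hmem
  rw [hset]
  refine MeasurableSet.union (MeasurableSet.iUnion fun i => ?_)
    ((hτ t).compl.inter ((hX t).measurable hs))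
  by_cases hi : v i ≤ t
  · simp only [hi, true_and, Set.ofPred_mem_eq]
    exact 𝓕.mono hi _ ((hτ.measurableSet_eq (v i)).inter ((hX (v i)).measurable hs))
  · simp only [hi, false_and, Set.ofPred_false]
    exact @MeasurableSet.empty _ (𝓕 t)

/-- A local martingale is a submartingale when stopped at a countably valued stopping time before
which it is bounded. -/
theorem submartingale_stoppedProcess_of_locally [IsFiniteMeasure μ]
    (hloc : Locally (fun Y => Martingale Y 𝓕 μ) 𝓕 X μ) (hX : StronglyAdapted 𝓕 X)
    {τ : Ω → WithTop ℝ≥0} (hτ : IsStoppingTime 𝓕 τ) (v : ℕ → ℝ≥0)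
    (hv : ∀ ω, τ ω = ⊤ ∨ ∃ i, τ ω = v i) {c : ℝ}
    (hbdd : ∀ᵐ ω ∂μ, ∀ u : ℝ≥0, (u : WithTop ℝ≥0) ≤ τ ω → |X u ω| ≤ c) :
    Submartingale (stoppedProcess X τ) 𝓕 μ := by
  obtain ⟨σ, hσ, hM⟩ := hloc
  let M : ℕ → ℝ≥0 → Ω → ℝ := fun n =>
    stoppedProcess (fun i => {ω | ⊥ < σ n ω}.indicator (X i)) (σ n)
  have hbM : ∀ᵐ ω ∂μ, ∀ n t, |(stoppedProcess (M n) τ t ω)| ≤ c := by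
    filter_upwards [hbdd] with ω hω n t
    obtain ⟨u, -, hu, h1⟩ := exists_stoppedProcess_eq τ t ω
    obtain ⟨w, hw, -, h2⟩ := exists_stoppedProcess_eq (σ n) u ω
    rw [h1]
    change |(stoppedProcess _ (σ n) u ω)| ≤ c
    rw [h2]
    have h3 := hω w ((WithTop.coe_le_coe.mpr hw).trans hu)
    by_cases hmem : ω ∈ {ω | ⊥ < σ n ω}
    · rwa [Set.indicator_of_mem hmem]
    · rw [Set.indicator_of_notMem hmem, abs_zero]
      exact (abs_nonneg _).trans h3
  have hsub : ∀ n, Submartingale (stoppedProcess (M n) τ) 𝓕 μ := fun n =>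
    Submartingale.stoppedProcess_of_countable (hM n).submartingale hτ v hv fun t =>
      (integrable_const c).mono'
        ((stronglyAdapted_stoppedProcess_of_countable (hM n).stronglyAdapted hτ v hv t).mono
          (𝓕.le t)).aestronglyMeasurable (hbM.mono fun ω hω => hω n t)
  have hadp := stronglyAdapted_stoppedProcess_of_countable hX hτ v hv
  have hint : ∀ t, Integrable (stoppedProcess X τ t) μ := fun t =>
    (integrable_const c).mono' ((hadp t).mono (𝓕.le t)).aestronglyMeasurable
      (hbdd.mono fun ω hω => by
        obtain ⟨u, -, hu, h1⟩ := exists_stoppedProcess_eq τ t ω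
        rw [h1]; exact hω u hu)
  have hlim : ∀ t, ∀ᵐ ω ∂μ, Tendsto (fun n => stoppedProcess (M n) τ t ω) atTop
      (𝓝 (stoppedProcess X τ t ω)) := by
    intro t
    filter_upwards [hσ.tendsto_top] with ω hω
    obtain ⟨u, -, -, h1⟩ := exists_stoppedProcess_eq τ t ω
    refine tendsto_const_nhds.congr' ?_
    filter_upwards [hω.eventually_const_lt (WithTop.coe_lt_top u)] with n hn
    rw [h1, h1]
    change X u ω = stoppedProcess _ (σ n) u ω
    have hpos : ω ∈ {ω | ⊥ < σ n ω} := lt_of_le_of_lt bot_le hn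
    rw [stoppedProcess_eq_of_le hn.le, Set.indicator_of_mem hpos]
  have hset : ∀ t A, Tendsto (fun n => ∫ ω in A, stoppedProcess (M n) τ t ω ∂μ) atTop
      (𝓝 (∫ ω in A, stoppedProcess X τ t ω ∂μ)) := fun t A =>
    tendsto_integral_of_dominated_convergence (fun _ => c)
      (fun n => ((hsub n).integrable t).aestronglyMeasurable.restrict) (integrable_const c)
      (fun n => ae_restrict_of_ae (hbM.mono fun ω hω => hω n t)) (ae_restrict_of_ae (hlim t))
  exact submartingale_of_setIntegral_le hadp hint fun s t hst A hA =>
    le_of_tendsto_of_tendsto' (hset s A) (hset t A) fun n => (hsub n).setIntegral_le hst hA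

/-- A continuous nonnegative local martingale minus a dominated nonnegative supermartingale is a
local submartingale, even if the supermartingale has no regular paths: the localizing times are
chosen countably valued, so that only countably many times matter. -/
theorem locally_submartingale_sub [IsFiniteMeasure μ]
    (hloc : Locally (fun Y => Martingale Y 𝓕 μ) 𝓕 X μ) (hX : ∀ t, Measurable[𝓕 t] (X t))
    (hr : ∀ ω t, ContinuousWithinAt (fun u => X u ω) (Set.Ici t) t)
    (hc : ∀ᵐ ω ∂μ, UniformContinuous fun u => X u ω)
    (hbd : ∀ᵐ ω ∂μ, ∃ C, ∀ u, X u ω ≤ C)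
    (hnn : ∀ᵐ ω ∂μ, ∀ u, 0 ≤ X u ω) {b : ℝ} (hb : ∀ ω, X 0 ω ≤ b)
    (hY : Supermartingale Y 𝓕 μ) (hYX : ∀ t, ∀ᵐ ω ∂μ, 0 ≤ Y t ω ∧ Y t ω ≤ X t ω) :
    Locally (fun Z => Submartingale Z 𝓕 μ) 𝓕 (fun t ω => X t ω - Y t ω) μ := by
  have hXs : StronglyAdapted 𝓕 X := fun t => (hX t).stronglyMeasurable
  have hex := fun n : ℕ => exists_countable_passage_time (𝓕 := 𝓕) (μ := μ) hX hr hc (b := b + n)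
    fun ω => (hb ω).trans (le_add_of_nonneg_right n.cast_nonneg)
  choose τ hst v hupper hlower hpos using hex
  choose v hv using v
  refine ⟨τ, ⟨⟨hst, ?_⟩, ?_⟩, fun n => ?_⟩
  · filter_upwards [hbd] with ω ⟨C, hC⟩
    refine tendsto_const_nhds.congr' ?_
    obtain ⟨N, hN⟩ := exists_nat_ge (C - b)
    filter_upwards [eventually_ge_atTop N] with n hn
    by_contra hne
    obtain ⟨u, -, hu⟩ := hlower n ω (Ne.symm hne)
    have h1 : (N : ℝ) ≤ n := by exact_mod_cast hn
    have h2 := hC u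
    linarith
  · filter_upwards [ae_all_iff.mpr hupper] with ω hω
    refine monotone_nat_of_le_succ fun n => ?_
    by_contra hcon
    have hlt := not_le.mp hcon
    obtain ⟨u, hu, hgt⟩ := hlower (n + 1) ω hlt.ne_top
    have h1 := hω n u (hu.trans hlt.le)
    push_cast at hgt
    linarith
  · have hbX : ∀ᵐ ω ∂μ, ∀ u : ℝ≥0, (u : WithTop ℝ≥0) ≤ τ n ω → |X u ω| ≤ b + n + 1 := by
      filter_upwards [hupper n, hnn] with ω h1 h2 u hu
      rw [abs_of_nonneg (h2 u)]
      exact h1 u hu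
    have hXsub := submartingale_stoppedProcess_of_locally hloc hXs (hst n) (v n) (hv n) hbX
    have hYadp : StronglyAdapted 𝓕 (-Y) := hY.neg.stronglyAdapted
    have hYbd : ∀ t, ∀ᵐ ω ∂μ, |(stoppedProcess (-Y) (τ n) t ω)| ≤ b + n + 1 := by
      intro t
      filter_upwards [hbX, hYX t, ae_all_iff.mpr fun i => hYX (v n i)] with ω h1 h2 h3
      have hu : ∀ u : ℝ≥0, (u : WithTop ℝ≥0) ≤ τ n ω → 0 ≤ Y u ω ∧ Y u ω ≤ X u ω →
          |(-Y) u ω| ≤ b + n + 1 := fun u hu h => by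
        rw [Pi.neg_apply, Pi.neg_apply, abs_neg, abs_of_nonneg h.1]
        exact h.2.trans ((le_abs_self _).trans (h1 u hu))
      rcases le_or_gt (t : WithTop ℝ≥0) (τ n ω) with hle | hlt
      · rw [stoppedProcess_eq_of_le hle]
        exact hu t hle h2
      · rcases hv n ω with h | ⟨i, h⟩
        · exact absurd hlt (by rw [h]; exact not_top_lt)
        · rw [stoppedProcess_apply_coe h, min_eq_right (by rw [h] at hlt; exact_mod_cast hlt.le)]
          exact hu _ h.ge (h3 i)
    have hYsub : Submartingale (stoppedProcess (-Y) (τ n)) 𝓕 μ :=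
      Submartingale.stoppedProcess_of_countable hY.neg (hst n) (v n) (hv n) fun t =>
        (integrable_const _).mono'
          ((stronglyAdapted_stoppedProcess_of_countable hYadp (hst n) (v n) (hv n) t).mono
            (𝓕.le t)).aestronglyMeasurable (hYbd t)
    have huniv : {ω | ⊥ < τ n ω} = Set.univ := Set.eq_univ_of_forall fun ω => hpos n ω
    simp only [huniv, Set.indicator_univ]
    have heq : stoppedProcess (fun t ω => X t ω - Y t ω) (τ n)
        = stoppedProcess X (τ n) + stoppedProcess (-Y) (τ n) := by
      funext t ω
      obtain ⟨u, -, -, h⟩ := exists_stoppedProcess_eq (τ n) t ω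
      rw [Pi.add_apply, Pi.add_apply, h, h, h, Pi.neg_apply, Pi.neg_apply, sub_eq_add_neg]
    rw [heq]
    exact hXsub.add hYsub

end LocalSubmartingale

/-! ### Nonnegative local martingales are supermartingales -/

section NonnegLocal

variable {Ω : Type*} {mΩ : MeasurableSpace Ω} {μ : Measure Ω}
  {𝓕 : Filtration ℝ≥0 mΩ} {X : ℝ≥0 → Ω → ℝ}

/-- Fatou's lemma along the localizing sequence, on the events `{s < σ k}` where the stopped process
at time `s` is eventually constant. No integrability is assumed. -/
theorem setLIntegral_le_of_locally [IsFiniteMeasure μ]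
    (hloc : Locally (fun Y => Martingale Y 𝓕 μ) 𝓕 X μ) (hX : StronglyAdapted 𝓕 X)
    (hnn : ∀ᵐ ω ∂μ, ∀ t, 0 ≤ X t ω) {s t : ℝ≥0} (hst : s ≤ t) {A : Set Ω}
    (hA : MeasurableSet[𝓕 s] A) :
    ∫⁻ ω in A, ENNReal.ofReal (X t ω) ∂μ ≤ ∫⁻ ω in A, ENNReal.ofReal (X s ω) ∂μ := by
  obtain ⟨σ, hσ, hM⟩ := hloc
  let M : ℕ → ℝ≥0 → Ω → ℝ := fun n =>
    stoppedProcess (fun i => {ω | ⊥ < σ n ω}.indicator (X i)) (σ n)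
  have hXm : ∀ u, Measurable (X u) := fun u => ((hX u).mono (𝓕.le u)).measurable
  have hMm : ∀ n u, Measurable (M n u) := fun n u =>
    (((hM n).stronglyAdapted u).mono (𝓕.le u)).measurable
  have hMeq : ∀ n (u : ℝ≥0) ω, (u : WithTop ℝ≥0) < σ n ω → M n u ω = X u ω := by
    intro n u ω h
    change stoppedProcess _ (σ n) u ω = _
    have hpos : ω ∈ {ω | ⊥ < σ n ω} := lt_of_le_of_lt bot_le h
    rw [stoppedProcess_eq_of_le h.le, Set.indicator_of_mem hpos]
  have hMnn : ∀ᵐ ω ∂μ, ∀ n u, 0 ≤ M n u ω := by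
    filter_upwards [hnn] with ω hω n u
    obtain ⟨w, -, -, h⟩ := exists_stoppedProcess_eq (σ n) u ω
    change 0 ≤ stoppedProcess _ (σ n) u ω
    rw [h]
    exact Set.indicator_apply_nonneg fun _ => hω w
  let A' : ℕ → Set Ω := fun k => A ∩ {ω | σ k ω ≤ s}ᶜ
  have hA' : ∀ k, MeasurableSet[𝓕 s] (A' k) := fun k =>
    hA.inter ((hσ.isStoppingTime k) s).compl
  have hA'm : ∀ k, MeasurableSet (A' k) := fun k => 𝓕.le s _ (hA' k)
  have hstep : ∀ k, ∫⁻ ω in A' k, ENNReal.ofReal (X t ω) ∂μ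
      ≤ ∫⁻ ω in A, ENNReal.ofReal (X s ω) ∂μ := by
    intro k
    have h1 : ∀ᵐ ω ∂(μ.restrict (A' k)), ENNReal.ofReal (X t ω)
        = liminf (fun n => ENNReal.ofReal (M n t ω)) atTop := by
      refine ae_restrict_of_ae ?_
      filter_upwards [hσ.tendsto_top] with ω hω
      refine (Tendsto.liminf_eq (tendsto_const_nhds.congr' ?_)).symm
      filter_upwards [hω.eventually_const_lt (WithTop.coe_lt_top t)] with n hn
      rw [hMeq n t ω hn]
    rw [lintegral_congr_ae h1]
    refine (lintegral_liminf_le fun n => (hMm n t).ennreal_ofReal).trans ?_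
    refine liminf_le_of_le (by isBoundedDefault) fun b hb => ?_
    obtain ⟨n, hkn, hn⟩ := ((eventually_ge_atTop k).and hb).exists
    refine hn.trans ?_
    have hnn' : ∀ u, 0 ≤ᵐ[μ.restrict (A' k)] M n u := fun u =>
      ae_restrict_of_ae (hMnn.mono fun ω h => h n u)
    rw [← ofReal_integral_eq_lintegral_ofReal ((hM n).integrable t).restrict (hnn' t),
      ← (hM n).setIntegral_eq hst (hA' k),
      ofReal_integral_eq_lintegral_ofReal ((hM n).integrable s).restrict (hnn' s)]
    refine le_trans (le_of_eq ?_)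
      (lintegral_mono_set (Set.inter_subset_left : A' k ⊆ A))
    refine setLIntegral_congr_fun_ae (hA'm k) ?_
    filter_upwards [hσ.mono] with ω hω hmem
    have hlt : (s : WithTop ℝ≥0) < σ k ω := by
      have hmem2 : ¬ σ k ω ≤ s := hmem.2
      exact not_le.mp hmem2
    have : (s : WithTop ℝ≥0) < σ n ω := hlt.trans_le (hω hkn)
    exact congrArg ENNReal.ofReal (hMeq n s ω this)
  have hAm : MeasurableSet A := 𝓕.le s _ hA
  calc ∫⁻ ω in A, ENNReal.ofReal (X t ω) ∂μ
      = ∫⁻ ω, liminf (fun k => (A' k).indicator (fun ω => ENNReal.ofReal (X t ω)) ω) atTop ∂μ := by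
        rw [← lintegral_indicator hAm]
        refine lintegral_congr_ae ?_
        filter_upwards [hσ.tendsto_top] with ω hω
        refine (Tendsto.liminf_eq (tendsto_const_nhds.congr' ?_)).symm
        filter_upwards [hω.eventually_const_lt (WithTop.coe_lt_top s)] with n hn
        by_cases hmem : ω ∈ A
        · rw [Set.indicator_of_mem hmem,
            Set.indicator_of_mem (show ω ∈ A' n from ⟨hmem, not_le.mpr hn⟩)]
        · rw [Set.indicator_of_notMem hmem,
            Set.indicator_of_notMem (show ω ∉ A' n from fun h => hmem h.1)]
    _ ≤ liminf (fun k => ∫⁻ ω, (A' k).indicator (fun ω => ENNReal.ofReal (X t ω)) ω ∂μ) atTop :=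
        lintegral_liminf_le fun k => (hXm t).ennreal_ofReal.indicator (hA'm k)
    _ ≤ _ := by
        refine liminf_le_of_le (by isBoundedDefault) fun b hb => ?_
        obtain ⟨k, hk⟩ := hb.exists
        rw [lintegral_indicator (hA'm k)] at hk
        exact hk.trans (hstep k)

theorem supermartingale_of_locally [IsFiniteMeasure μ]
    (hloc : Locally (fun Y => Martingale Y 𝓕 μ) 𝓕 X μ) (hX : StronglyAdapted 𝓕 X)
    (hnn : ∀ᵐ ω ∂μ, ∀ t, 0 ≤ X t ω) (h0 : Integrable (X 0) μ) : Supermartingale X 𝓕 μ := by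
  have hnn' : ∀ t, 0 ≤ᵐ[μ] X t := fun t => hnn.mono fun ω h => h t
  have hint : ∀ t, Integrable (X t) μ := by
    intro t
    refine ⟨((hX t).mono (𝓕.le t)).aestronglyMeasurable, ?_⟩
    rw [hasFiniteIntegral_iff_ofReal (hnn' t)]
    have h := setLIntegral_le_of_locally hloc hX hnn (zero_le (a := t)) MeasurableSet.univ
    rw [setLIntegral_univ, setLIntegral_univ] at h
    exact h.trans_lt ((hasFiniteIntegral_iff_ofReal (hnn' 0)).mp h0.2)
  have hneg : Submartingale (-X) 𝓕 μ := by
    refine submartingale_of_setIntegral_le hX.neg (fun t => (hint t).neg) fun s t hst A hA => ?_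
    simp only [Pi.neg_apply, integral_neg]
    rw [neg_le_neg_iff]
    have h := setLIntegral_le_of_locally hloc hX hnn hst hA
    rw [← ofReal_integral_eq_lintegral_ofReal (hint t).restrict (ae_restrict_of_ae (hnn' t)),
      ← ofReal_integral_eq_lintegral_ofReal (hint s).restrict (ae_restrict_of_ae (hnn' s))] at h
    exact (ENNReal.ofReal_le_ofReal_iff
      (integral_nonneg_of_ae (ae_restrict_of_ae (hnn' s)))).mp h
  simpa using hneg.neg

end NonnegLocal

/-! ### Priors agreeing up to a given time -/

section Agreeing

variable {d : ℕ} {Q R : ProbabilityMeasure (PathSpace d)}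

theorem ext_trim_eq {m : MeasurableSpace (PathSpace d)} (hm : m ≤ univMeas d)
    (h : ∀ A, MeasurableSet[m] A → ext R A = ext Q A) : (ext R).trim hm = (ext Q).trim hm := by
  refine @Measure.ext _ m _ _ fun B hB => ?_
  rw [trim_measurableSet_eq hm hB, trim_measurableSet_eq hm hB, h B hB]

theorem setIntegral_eq_of_agree {m : MeasurableSpace (PathSpace d)} (hm : m ≤ univMeas d)
    (h : ∀ A, MeasurableSet[m] A → ext R A = ext Q A) {f : PathSpace d → ℝ}
    (hf : StronglyMeasurable[m] f) {A : Set (PathSpace d)} (hA : MeasurableSet[m] A) :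
    ∫ ω in A, f ω ∂(ext R) = ∫ ω in A, f ω ∂(ext Q) := by
  rw [setIntegral_trim hm hf hA, setIntegral_trim hm hf hA, ext_trim_eq hm h]

theorem integrable_of_agree {m : MeasurableSpace (PathSpace d)} (hm : m ≤ univMeas d)
    (h : ∀ A, MeasurableSet[m] A → ext R A = ext Q A) {f : PathSpace d → ℝ}
    (hf : StronglyMeasurable[m] f) (hi : Integrable f (ext R)) : Integrable f (ext Q) := by
  have h1 := hi.trim hm hf
  rw [ext_trim_eq hm h] at h1
  exact integrable_of_integrable_trim hm h1

theorem ae_of_agree {m : MeasurableSpace (PathSpace d)} (hm : m ≤ univMeas d)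
    (h : ∀ A, MeasurableSet[m] A → ext R A = ext Q A) {p : PathSpace d → Prop}
    (hp : MeasurableSet[universalCompletion m] {ω | p ω}) (hR : ∀ᵐ ω ∂(ext R), p ω) :
    ∀ᵐ ω ∂(ext Q), p ω := by
  rw [ae_iff] at hR ⊢
  exact (ext_eq_of_universalCompletion hm h hp.compl).symm.trans hR

/-- Conditioning a variable measurable for the universal completion does not change it. -/
theorem condExp_of_universalCompletion {m : MeasurableSpace (PathSpace d)} (hm : m ≤ univMeas d)
    {f : PathSpace d → ℝ} (hf : Measurable[universalCompletion m] f)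
    (hi : Integrable f (ext Q)) : (ext Q)[f | m] =ᵐ[ext Q] f := by
  obtain ⟨g, hg, hfg⟩ := exists_ae_eq_measurable_ext Q hm hf
  have h1 : (ext Q)[g | m] = g :=
    condExp_of_stronglyMeasurable hm hg.stronglyMeasurable (hi.congr hfg)
  exact (condExp_congr_ae hfg).trans (by rw [h1]; exact hfg.symm)

variable {P : ProbabilityMeasure (PathSpace d)} {A : Set (PathSpace d)}

theorem ext_paste_apply (hA : MeasurableSet A)
    (h : (P : Measure (PathSpace d))
      = (R : Measure (PathSpace d)).restrict A + (Q : Measure (PathSpace d)).restrict Aᶜ)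
    (D : Set (PathSpace d)) : ext P D = ext R (D ∩ A) + ext Q (D ∩ Aᶜ) := by
  rw [ext_apply, ext_apply, ext_apply, h, Measure.add_apply, Measure.restrict_apply' hA,
    Measure.restrict_apply' hA.compl]

theorem ext_paste_restrict (hA : MeasurableSet A)
    (h : (P : Measure (PathSpace d))
      = (R : Measure (PathSpace d)).restrict A + (Q : Measure (PathSpace d)).restrict Aᶜ) :
    (ext P).restrict A = (ext R).restrict A ∧ (ext P).restrict Aᶜ = (ext Q).restrict Aᶜ := by
  have hA' : MeasurableSet[univMeas d] A := borel_le_univMeas A hA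
  constructor
  · refine @Measure.ext _ (univMeas d) _ _ fun D _ => ?_
    rw [Measure.restrict_apply' hA', Measure.restrict_apply' hA', ext_paste_apply hA h,
      Set.inter_assoc, Set.inter_self, Set.inter_assoc, Set.inter_compl_self, Set.inter_empty,
      measure_empty, add_zero]
  · refine @Measure.ext _ (univMeas d) _ _ fun D _ => ?_
    rw [Measure.restrict_apply' hA'.compl, Measure.restrict_apply' hA'.compl,
      ext_paste_apply hA h, Set.inter_assoc, Set.compl_inter_self, Set.inter_empty,
      measure_empty, zero_add, Set.inter_assoc, Set.inter_self]

theorem setIntegral_paste (hA : MeasurableSet A)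
    (h : (P : Measure (PathSpace d))
      = (R : Measure (PathSpace d)).restrict A + (Q : Measure (PathSpace d)).restrict Aᶜ)
    {D : Set (PathSpace d)} (f : PathSpace d → ℝ) :
    (D ⊆ A → ∫ ω in D, f ω ∂(ext P) = ∫ ω in D, f ω ∂(ext R)) ∧
      (D ⊆ Aᶜ → ∫ ω in D, f ω ∂(ext P) = ∫ ω in D, f ω ∂(ext Q)) := by
  obtain ⟨h1, h2⟩ := ext_paste_restrict hA h
  constructor
  · intro hD
    rw [← Measure.restrict_restrict_of_subset hD, h1, Measure.restrict_restrict_of_subset hD]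
  · intro hD
    rw [← Measure.restrict_restrict_of_subset hD, h2, Measure.restrict_restrict_of_subset hD]

end Agreeing

/-! ### Conditional sublinear expectations -/

section EssSup

variable {d : ℕ} {𝒬 : ℝ≥0 → PathSpace d → Set (ProbabilityMeasure (PathSpace d))}
  {Q : ProbabilityMeasure (PathSpace d)} {t : ℝ≥0} {ξ : PathSpace d → ℝ}

theorem self_mem_agreeingPriors {𝒬₀ : Set (ProbabilityMeasure (PathSpace d))} (hQ : Q ∈ 𝒬₀)
    (m : MeasurableSpace (PathSpace d)) : Q ∈ agreeingPriors 𝒬₀ Q m := ⟨hQ, fun _ _ => rfl⟩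

theorem setIntegral_condExp_of_agree {𝒬₀ : Set (ProbabilityMeasure (PathSpace d))}
    {R : ProbabilityMeasure (PathSpace d)}
    {m : MeasurableSpace (PathSpace d)} (hm : m ≤ univMeas d)
    (hR : R ∈ agreeingPriors 𝒬₀ Q m) (hi : Integrable ξ (ext R)) {A : Set (PathSpace d)}
    (hA : MeasurableSet[m] A) :
    ∫ ω in A, ((ext R)[ξ | m]) ω ∂(ext Q) = ∫ ω in A, ξ ω ∂(ext R) := by
  rw [← setIntegral_eq_of_agree hm hR.2 stronglyMeasurable_condExp hA, setIntegral_condExp hm hi hA]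

theorem integrable_condExp_of_agree {𝒬₀ : Set (ProbabilityMeasure (PathSpace d))}
    {R : ProbabilityMeasure (PathSpace d)}
    {m : MeasurableSpace (PathSpace d)} (hm : m ≤ univMeas d)
    (hR : R ∈ agreeingPriors 𝒬₀ Q m) : Integrable ((ext R)[ξ | m]) (ext Q) :=
  integrable_of_agree hm hR.2 stronglyMeasurable_condExp integrable_condExp

/-- The conditional expectations of `ξ` under the priors agreeing with `Q` on `F_t` are directed
upwards: pasting the second prior into the first on the event where it gives the larger value
realizes the maximum. -/
theorem exists_condExp_ge_max (h𝒬 : IsStableFamily 𝒬)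
    (hξ : ∀ Q ∈ priors 𝒬, Integrable ξ (ext Q)) {R₁ R₂ : ProbabilityMeasure (PathSpace d)}
    (h₁ : R₁ ∈ agreeingPriors (priors 𝒬) Q (rawFiltration d t))
    (h₂ : R₂ ∈ agreeingPriors (priors 𝒬) Q (rawFiltration d t)) :
    ∃ R ∈ agreeingPriors (priors 𝒬) Q (rawFiltration d t),
      (ext R₁)[ξ | rawFiltration d t] ≤ᵐ[ext Q] (ext R)[ξ | rawFiltration d t] ∧
      (ext R₂)[ξ | rawFiltration d t] ≤ᵐ[ext Q] (ext R)[ξ | rawFiltration d t] := by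
  classical
  have hm := rawFiltration_le_univMeas (d := d) t
  set Y₁ := (ext R₁)[ξ | rawFiltration d t] with hY₁
  set Y₂ := (ext R₂)[ξ | rawFiltration d t] with hY₂
  have hY₁m : StronglyMeasurable[rawFiltration d t] Y₁ := stronglyMeasurable_condExp
  have hY₂m : StronglyMeasurable[rawFiltration d t] Y₂ := stronglyMeasurable_condExp
  let A : Set (PathSpace d) := {ω | Y₁ ω < Y₂ ω}
  have hA : MeasurableSet[rawFiltration d t] A :=
    StronglyMeasurable.measurableSet_lt hY₁m hY₂m
  have hAb : MeasurableSet A := (rawFiltration d).le t _ hA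
  obtain ⟨R, hR, hRe⟩ := exists_paste h𝒬 h₁.1 h₂.1
    (fun B hB => (h₂.2 B hB).trans (h₁.2 B hB).symm) hA
  have hRag : R ∈ agreeingPriors (priors 𝒬) Q (rawFiltration d t) := by
    refine ⟨hR, fun B hB => ?_⟩
    rw [ext_paste_apply hAb hRe, h₂.2 _ (hB.inter hA), h₁.2 _ (hB.inter hA.compl)]
    exact measure_inter_add_sdiff B (hm _ hA)
  let g : PathSpace d → ℝ := fun ω => max (Y₁ ω) (Y₂ ω)
  have hg : StronglyMeasurable[rawFiltration d t] g :=
    (continuous_fst.max continuous_snd).comp_stronglyMeasurable (hY₁m.prodMk hY₂m)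
  have hgiQ : Integrable g (ext Q) :=
    (integrable_condExp_of_agree hm h₁).sup (integrable_condExp_of_agree hm h₂)
  have hgiR : Integrable g (ext R) :=
    integrable_of_agree hm (fun B hB => (hRag.2 B hB).symm) hg hgiQ
  have hset : ∀ B, MeasurableSet[rawFiltration d t] B →
      ∫ ω in B, g ω ∂(ext R) = ∫ ω in B, ξ ω ∂(ext R) := by
    intro B hB
    rw [setIntegral_eq_of_agree hm hRag.2 hg hB,
      ← integral_inter_add_sdiff (hm _ hA) hgiQ.integrableOn,
      ← integral_inter_add_sdiff (hm _ hA) (hξ R hR).integrableOn,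
      (setIntegral_paste hAb hRe ξ).1 Set.inter_subset_right,
      (setIntegral_paste hAb hRe ξ).2 (fun ω h => h.2),
      ← setIntegral_condExp_of_agree hm h₂ (hξ R₂ h₂.1) (hB.inter hA),
      ← setIntegral_condExp_of_agree hm h₁ (hξ R₁ h₁.1) (hB.diff hA)]
    congr 1
    · exact setIntegral_congr_fun (hm _ (hB.inter hA)) fun ω h => max_eq_right (le_of_lt h.2)
    · exact setIntegral_congr_fun (hm _ (hB.diff hA)) fun ω h => max_eq_left (not_lt.mp h.2)
  have hgeq : g =ᵐ[ext R] (ext R)[ξ | rawFiltration d t] :=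
    ae_eq_condExp_of_forall_setIntegral_eq hm (hξ R hR) (fun _ _ _ => hgiR.integrableOn)
      (fun B hB _ => hset B hB) hg.aestronglyMeasurable
  have hgeQ : g =ᵐ[ext Q] (ext R)[ξ | rawFiltration d t] :=
    ae_of_agree hm hRag.2 (le_universalCompletion _ _
      (StronglyMeasurable.measurableSet_eq_fun hg stronglyMeasurable_condExp)) hgeq
  exact ⟨R, hRag, hgeQ.mono fun ω h => (le_max_left _ _).trans h.le,
    hgeQ.mono fun ω h => (le_max_right _ _).trans h.le⟩

/-- The expectation of a conditional sublinear expectation of a bounded family is approached by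
the expectations of `ξ` under the agreeing priors: by directedness, the essential supremum is the
limit of an increasing sequence of conditional expectations. -/
theorem exists_integral_le_add (h𝒬 : IsStableFamily 𝒬) (hQ : Q ∈ priors 𝒬)
    (hξ : ∀ Q ∈ priors 𝒬, Integrable ξ (ext Q)) {U V : PathSpace d → ℝ}
    (hU : Integrable U (ext Q))
    (hYU : ∀ R ∈ agreeingPriors (priors 𝒬) Q (rawFiltration d t),
      (ext R)[ξ | rawFiltration d t] ≤ᵐ[ext Q] U)
    (hV : IsConditionalSublinearExpectation (priors 𝒬) Q (rawFiltration d t) ξ V)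
    {ε : ℝ} (hε : 0 < ε) :
    ∃ R ∈ agreeingPriors (priors 𝒬) Q (rawFiltration d t),
      ∫ ω, V ω ∂(ext Q) ≤ ∫ ω, ξ ω ∂(ext R) + ε := by
  have hm := rawFiltration_le_univMeas (d := d) t
  let 𝒜 := agreeingPriors (priors 𝒬) Q (rawFiltration d t)
  have hY : ∀ R ∈ 𝒜, ∫ ω, ((ext R)[ξ | rawFiltration d t]) ω ∂(ext Q) = ∫ ω, ξ ω ∂(ext R) := by
    intro R hR
    have := setIntegral_condExp_of_agree hm hR (hξ R hR.1) MeasurableSet.univ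
    rwa [setIntegral_univ, setIntegral_univ] at this
  have hYi : ∀ R ∈ 𝒜, Integrable ((ext R)[ξ | rawFiltration d t]) (ext Q) := fun R hR =>
    integrable_condExp_of_agree hm hR
  let I : Set ℝ := {x | ∃ R ∈ 𝒜, x = ∫ ω, ξ ω ∂(ext R)}
  have hIne : I.Nonempty := ⟨_, Q, self_mem_agreeingPriors hQ _, rfl⟩
  have hIbdd : BddAbove I := by
    refine ⟨∫ ω, U ω ∂(ext Q), ?_⟩
    rintro _ ⟨R, hR, rfl⟩
    rw [← hY R hR]
    exact integral_mono_ae (hYi R hR) hU (hYU R hR)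
  have hle : ∀ R ∈ 𝒜, ∫ ω, ((ext R)[ξ | rawFiltration d t]) ω ∂(ext Q) ≤ sSup I := fun R hR =>
    (hY R hR).le.trans (le_csSup hIbdd ⟨R, hR, rfl⟩)
  have hex : ∀ n : ℕ, ∃ R ∈ 𝒜, sSup I - 1 / ((n : ℝ) + 1)
      < ∫ ω, ((ext R)[ξ | rawFiltration d t]) ω ∂(ext Q) := by
    intro n
    obtain ⟨_, ⟨R, hR, rfl⟩, hlt⟩ := exists_lt_of_lt_csSup hIne
      (show sSup I - 1 / ((n : ℝ) + 1) < sSup I from sub_lt_self _ (by positivity))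
    exact ⟨R, hR, by rwa [hY R hR]⟩
  choose R hR hRlt using hex
  let Y : ℕ → PathSpace d → ℝ := fun n => (ext (R n))[ξ | rawFiltration d t]
  let W : ℕ → PathSpace d → ℝ := fun n => partialSups Y n
  have hWR : ∀ n, ∃ R' ∈ 𝒜, W n ≤ᵐ[ext Q] (ext R')[ξ | rawFiltration d t] := by
    intro n
    induction n with
    | zero => exact ⟨R 0, hR 0, by simp [W, Y, EventuallyLE.refl]⟩
    | succ n ih =>
      obtain ⟨R', hR', h1⟩ := ih
      obtain ⟨R'', hR'', h2, h3⟩ := exists_condExp_ge_max h𝒬 hξ hR' (hR (n + 1))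
      refine ⟨R'', hR'', ?_⟩
      filter_upwards [h1, h2, h3] with ω a1 a2 a3
      change partialSups Y (n + 1) ω ≤ _
      rw [partialSups_add_one, Pi.sup_apply]
      exact sup_le (a1.trans a2) a3
  have hYW : ∀ n, Y n ≤ W n := fun n => le_partialSups Y n
  have hWi : ∀ n, Integrable (W n) (ext Q) := by
    intro n
    induction n with
    | zero => simpa [W, Y] using hYi _ (hR 0)
    | succ n ih =>
      change Integrable (partialSups Y (n + 1)) (ext Q)
      rw [partialSups_add_one]
      exact ih.sup (hYi _ (hR (n + 1)))
  have hmono : ∀ ω, Monotone fun n => W n ω := fun ω n k hnk => (partialSups Y).monotone hnk ω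
  have hWU : ∀ᵐ ω ∂(ext Q), ∀ n, W n ω ≤ U ω := by
    refine ae_all_iff.mpr fun n => ?_
    obtain ⟨R', hR', h1⟩ := hWR n
    exact h1.trans (hYU R' hR')
  let Z : PathSpace d → ℝ := fun ω => ⨆ n, W n ω
  have hlim : ∀ᵐ ω ∂(ext Q), Tendsto (fun n => W n ω) atTop (𝓝 (Z ω)) := by
    filter_upwards [hWU] with ω hω
    exact tendsto_atTop_ciSup (hmono ω) ⟨U ω, by rintro _ ⟨n, rfl⟩; exact hω n⟩
  have hWZ : ∀ᵐ ω ∂(ext Q), ∀ n, W n ω ≤ Z ω := by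
    filter_upwards [hlim] with ω hω n
    exact (hmono ω).ge_of_tendsto hω n
  have hZm : AEMeasurable Z (ext Q) :=
    (aestronglyMeasurable_of_tendsto_ae atTop (fun n => (hWi n).aestronglyMeasurable)
      hlim).aemeasurable
  have hbound : ∀ n, ∀ᵐ ω ∂(ext Q), ‖W n ω‖ ≤ |W 0 ω| + |U ω| := by
    intro n
    filter_upwards [hWU] with ω hω
    have h1 := hmono ω (Nat.zero_le n)
    have h2 := hω n
    rw [Real.norm_eq_abs, abs_le]
    constructor
    · have := neg_abs_le (W 0 ω)
      have := abs_nonneg (U ω)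
      simp only at h1
      linarith
    · have := le_abs_self (U ω)
      have := abs_nonneg (W 0 ω)
      linarith
  have hZlim : Tendsto (fun n => ∫ ω, W n ω ∂(ext Q)) atTop (𝓝 (∫ ω, Z ω ∂(ext Q))) :=
    tendsto_integral_of_dominated_convergence _ (fun n => (hWi n).aestronglyMeasurable)
      ((hWi 0).abs.add hU.abs) hbound hlim
  have hZi : Integrable Z (ext Q) := by
    refine ((hWi 0).abs.add hU.abs).mono' hZm.aestronglyMeasurable ?_
    filter_upwards [hlim, ae_all_iff.mpr hbound] with ω h1 h2
    exact le_of_tendsto' h1.norm h2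
  have hZle : ∫ ω, Z ω ∂(ext Q) ≤ sSup I := by
    refine le_of_tendsto' hZlim fun n => ?_
    obtain ⟨R', hR', h1⟩ := hWR n
    exact (integral_mono_ae (hWi n) (hYi R' hR') h1).trans (hle R' hR')
  -- `Z` dominates the whole family, as no member can raise the expectation of `W n` above `sSup I`.
  have hZub : ∀ R' ∈ 𝒜, (ext R')[ξ | rawFiltration d t] ≤ᵐ[ext Q] Z := by
    intro R' hR'
    set Y' := (ext R')[ξ | rawFiltration d t] with hY'
    have hi : ∀ n, Integrable (fun ω => max (Y' ω) (W n ω) - W n ω) (ext Q) := fun n =>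
      ((hYi R' hR').sup (hWi n)).sub (hWi n)
    have h0i : Integrable (fun ω => max (Y' ω) (Z ω) - Z ω) (ext Q) :=
      ((hYi R' hR').sup hZi).sub hZi
    have hsmall : ∀ n : ℕ, ∫ ω, (max (Y' ω) (Z ω) - Z ω) ∂(ext Q) ≤ 1 / ((n : ℝ) + 1) := by
      intro n
      obtain ⟨R'', hR'', h1⟩ := hWR n
      obtain ⟨R₃, hR₃, h2, h3⟩ := exists_condExp_ge_max h𝒬 hξ hR' hR''
      have h4 : ∫ ω, max (Y' ω) (W n ω) ∂(ext Q) ≤ sSup I := by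
        refine (integral_mono_ae ((hYi R' hR').sup (hWi n)) (hYi R₃ hR₃) ?_).trans (hle R₃ hR₃)
        filter_upwards [h1, h2, h3] with ω a1 a2 a3
        exact max_le a2 (a1.trans a3)
      have h5 : sSup I - 1 / ((n : ℝ) + 1) ≤ ∫ ω, W n ω ∂(ext Q) :=
        (hRlt n).le.trans (integral_mono (hYi _ (hR n)) (hWi n) (hYW n))
      calc ∫ ω, (max (Y' ω) (Z ω) - Z ω) ∂(ext Q)
          ≤ ∫ ω, (max (Y' ω) (W n ω) - W n ω) ∂(ext Q) := by
            refine integral_mono_ae h0i (hi n) ?_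
            filter_upwards [hWZ] with ω hω
            have := hω n
            have h8 : max (Y' ω) (Z ω) ≤ max (Y' ω) (W n ω) + (Z ω - W n ω) :=
              max_le (by linarith [le_max_left (Y' ω) (W n ω)])
                (by linarith [le_max_right (Y' ω) (W n ω)])
            linarith
        _ = ∫ ω, max (Y' ω) (W n ω) ∂(ext Q) - ∫ ω, W n ω ∂(ext Q) :=
            integral_sub ((hYi R' hR').sup (hWi n)) (hWi n)
        _ ≤ _ := by linarith
    have hzero : ∫ ω, (max (Y' ω) (Z ω) - Z ω) ∂(ext Q) ≤ 0 :=
      ge_of_tendsto' tendsto_one_div_add_atTop_nhds_zero_nat hsmall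
    have hnn : 0 ≤ fun ω => max (Y' ω) (Z ω) - Z ω := fun ω => sub_nonneg.mpr (le_max_right _ _)
    have h6 := (integral_eq_zero_iff_of_nonneg hnn h0i).mp
      (le_antisymm hzero (integral_nonneg hnn))
    filter_upwards [h6] with ω hω
    have h7 : max (Y' ω) (Z ω) - Z ω = 0 := hω
    exact (le_max_left _ _).trans (sub_eq_zero.mp h7).le
  have hVZ : V ≤ᵐ[ext Q] Z := by
    refine hV.2.2 Z hZm ?_
    rintro _ ⟨R', hR', rfl⟩
    exact hZub R' hR'
  have hVY : Y 0 ≤ᵐ[ext Q] V := hV.2.1 _ ⟨R 0, hR 0, rfl⟩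
  have hVi : Integrable V (ext Q) := by
    refine ((hYi _ (hR 0)).abs.add hZi.abs).mono' hV.1.aestronglyMeasurable ?_
    filter_upwards [hVZ, hVY] with ω h1 h2
    rw [Real.norm_eq_abs]
    exact (abs_le_max_abs_abs h2 h1).trans
      (max_le (le_add_of_nonneg_right (abs_nonneg _)) (le_add_of_nonneg_left (abs_nonneg _)))
  have hfin : ∫ ω, V ω ∂(ext Q) ≤ sSup I := (integral_mono_ae hVi hZi hVZ).trans hZle
  obtain ⟨_, ⟨R', hR', rfl⟩, hlt⟩ := exists_lt_of_lt_csSup hIne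
    (show sSup I - ε < sSup I from sub_lt_self _ hε)
  exact ⟨R', hR', by linarith⟩

end EssSup

/-! ### The robust fundamental value -/

section FundamentalValue

variable {d : ℕ} {𝒬 : ℝ≥0 → PathSpace d → Set (ProbabilityMeasure (PathSpace d))}
  {T : ℝ≥0} {S Sstar : ℝ≥0 → PathSpace d → ℝ} {Q : ProbabilityMeasure (PathSpace d)}

theorem integrable_of_supermartingale
    (hS : Supermartingale (fun t => S (min t T)) (starFiltration d) (ext Q)) {t : ℝ≥0}
    (ht : t ≤ T) : Integrable (S t) (ext Q) := by
  simpa [min_eq_left ht] using hS.integrable t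

theorem condExp_le_of_supermartingale
    (hS : ∀ Q ∈ priors 𝒬, Supermartingale (fun t => S (min t T)) (starFiltration d) (ext Q))
    (hSm : ∀ t, Measurable[starFiltration d t] (S t)) {t : ℝ≥0} (ht : t ≤ T)
    {R : ProbabilityMeasure (PathSpace d)}
    (hR : R ∈ agreeingPriors (priors 𝒬) Q (rawFiltration d t)) :
    (ext R)[S T | rawFiltration d t] ≤ᵐ[ext Q] S t := by
  have hm := rawFiltration_le_univMeas (d := d) t
  refine ae_of_agree hm hR.2 (p := fun ω => ((ext R)[S T | rawFiltration d t]) ω ≤ S t ω)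
    (@measurableSet_le _ _ _ _ _ (universalCompletion (rawFiltration d t)) _ _ _ _ _
      (stronglyMeasurable_condExp.measurable.mono (le_universalCompletion _) le_rfl) (hSm t)) ?_
  have h1 : (ext R)[S T | starFiltration d t] ≤ᵐ[ext R] S t := by
    have := (hS R hR.1).condExp_ae_le ht
    simpa [min_eq_left ht] using this
  have hint := integrable_of_supermartingale (hS R hR.1) ht
  have h2 : (ext R)[(ext R)[S T | starFiltration d t] | rawFiltration d t]
      =ᵐ[ext R] (ext R)[S T | rawFiltration d t] :=
    condExp_condExp_of_le (le_universalCompletion _) ((starFiltration d).le t)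
  have h3 := condExp_mono (m := rawFiltration d t) integrable_condExp hint h1
  filter_upwards [h2, h3, condExp_of_universalCompletion (Q := R) hm (hSm t) hint]
    with ω a1 a2 a3
  rw [← a1, ← a3]
  exact a2

theorem fundamentalValue_le (hSstar : IsRobustFundamentalValue (priors 𝒬) T S Sstar)
    (hS : ∀ Q ∈ priors 𝒬, Supermartingale (fun t => S (min t T)) (starFiltration d) (ext Q))
    (hSm : ∀ t, Measurable[starFiltration d t] (S t)) (hQ : Q ∈ priors 𝒬) {t : ℝ≥0}
    (ht : t ≤ T) : Sstar t ≤ᵐ[ext Q] S t := by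
  refine (hSstar.eq_essSup t ht Q hQ).2.2 (S t)
    (integrable_of_supermartingale (hS Q hQ) ht).aemeasurable ?_
  rintro _ ⟨R, hR, rfl⟩
  exact condExp_le_of_supermartingale hS hSm ht hR

theorem fundamentalValue_nonneg (hSstar : IsRobustFundamentalValue (priors 𝒬) T S Sstar)
    (hnn : ∀ᵐ ω ∂(ext Q), ∀ t ≤ T, 0 ≤ S t ω) (hQ : Q ∈ priors 𝒬) {t : ℝ≥0}
    (ht : t ≤ T) : 0 ≤ᵐ[ext Q] Sstar t :=
  (condExp_nonneg (hnn.mono fun _ h => h T le_rfl)).trans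
    ((hSstar.eq_essSup t ht Q hQ).2.1 _ ⟨Q, self_mem_agreeingPriors hQ _, rfl⟩)

theorem fundamentalValue_terminal (hSstar : IsRobustFundamentalValue (priors 𝒬) T S Sstar)
    (hS : ∀ Q ∈ priors 𝒬, Supermartingale (fun t => S (min t T)) (starFiltration d) (ext Q))
    (hSm : ∀ t, Measurable[starFiltration d t] (S t)) (hQ : Q ∈ priors 𝒬) :
    Sstar T =ᵐ[ext Q] S T := by
  refine (fundamentalValue_le hSstar hS hSm hQ le_rfl).antisymm ?_
  have h := (hSstar.eq_essSup T le_rfl Q hQ).2.1 _ ⟨Q, self_mem_agreeingPriors hQ _, rfl⟩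
  exact (condExp_of_universalCompletion (rawFiltration_le_univMeas T) (hSm T)
    (integrable_of_supermartingale (hS Q hQ) le_rfl)).symm.le.trans h

/-- The fundamental value is a supermartingale under every prior: a prior that is nearly optimal
at time `t` competes in the essential supremum at every earlier time `s`. -/
theorem fundamentalValue_supermartingale (h𝒬 : IsStableFamily 𝒬)
    (hSstar : IsRobustFundamentalValue (priors 𝒬) T S Sstar)
    (hS : ∀ Q ∈ priors 𝒬, Supermartingale (fun t => S (min t T)) (starFiltration d) (ext Q))
    (hSm : ∀ t, Measurable[starFiltration d t] (S t))
    (hnn : ∀ᵐ ω ∂(ext Q), ∀ t ≤ T, 0 ≤ S t ω) (hQ : Q ∈ priors 𝒬) :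
    Supermartingale (fun t => Sstar (min t T)) (starFiltration d) (ext Q) := by
  have hξ : ∀ Q ∈ priors 𝒬, Integrable (S T) (ext Q) := fun Q hQ =>
    integrable_of_supermartingale (hS Q hQ) le_rfl
  have hint : ∀ t ≤ T, Integrable (Sstar t) (ext Q) := by
    intro t ht
    refine (integrable_of_supermartingale (hS Q hQ) ht).mono'
      (hSstar.eq_essSup t ht Q hQ).1.aestronglyMeasurable ?_
    filter_upwards [fundamentalValue_le hSstar hS hSm hQ ht,
      fundamentalValue_nonneg hSstar hnn hQ ht] with ω h1 h2
    rw [Real.norm_eq_abs, abs_of_nonneg h2]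
    exact h1
  have hraw : ∀ s t, s ≤ t → t ≤ T → ∀ B, MeasurableSet[rawFiltration d s] B →
      ∫ ω in B, Sstar t ω ∂(ext Q) ≤ ∫ ω in B, Sstar s ω ∂(ext Q) := by
    intro s t hst ht B hB
    have hms := rawFiltration_le_univMeas (d := d) s
    have hmt := rawFiltration_le_univMeas (d := d) t
    have hBt : MeasurableSet[rawFiltration d t] B := (rawFiltration d).mono hst _ hB
    refine le_of_forall_pos_le_add fun ε hε => ?_
    have hV := hSstar.eq_essSup t ht Q hQ
    obtain ⟨R, hR, hle⟩ := exists_integral_le_add h𝒬 hQ hξ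
      (integrable_of_supermartingale (hS Q hQ) ht)
      (fun R hR => condExp_le_of_supermartingale hS hSm ht hR) hV hε
    have hRs : R ∈ agreeingPriors (priors 𝒬) Q (rawFiltration d s) :=
      ⟨hR.1, fun A hA => hR.2 A ((rawFiltration d).mono hst _ hA)⟩
    have hYi := integrable_condExp_of_agree (ξ := S T) hmt hR
    have hYV : (ext R)[S T | rawFiltration d t] ≤ᵐ[ext Q] Sstar t := hV.2.1 _ ⟨R, hR, rfl⟩
    have h1 := integral_add_compl (hmt _ hBt) (hint t ht)
    have h2 := integral_add_compl (hmt _ hBt) (hξ R hR.1)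
    have h3 : ∫ ω in Bᶜ, S T ω ∂(ext R) ≤ ∫ ω in Bᶜ, Sstar t ω ∂(ext Q) := by
      rw [← setIntegral_condExp_of_agree hmt hR (hξ R hR.1) hBt.compl]
      exact setIntegral_mono_ae hYi.integrableOn (hint t ht).integrableOn hYV
    have h4 : ∫ ω in B, S T ω ∂(ext R) ≤ ∫ ω in B, Sstar s ω ∂(ext Q) := by
      rw [← setIntegral_condExp_of_agree hms hRs (hξ R hR.1) hB]
      exact setIntegral_mono_ae (integrable_condExp_of_agree hms hRs).integrableOn
        (hint s (hst.trans ht)).integrableOn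
        ((hSstar.eq_essSup s (hst.trans ht) Q hQ).2.1 _ ⟨R, hRs, rfl⟩)
    linarith
  have hneg : Submartingale (-fun t => Sstar (min t T)) (starFiltration d) (ext Q) := by
    refine submartingale_of_setIntegral_le (fun t => ?_)
      (fun t => (hint _ (min_le_right t T)).neg) fun s t hst A hA => ?_
    · exact (((hSstar.adapted _ (min_le_right t T)).mono
        ((starFiltration d).mono (min_le_left t T)) le_rfl).neg).stronglyMeasurable
    · simp only [Pi.neg_apply, integral_neg]
      rw [neg_le_neg_iff]
      rcases le_or_gt s T with hs | hs
      · obtain ⟨B, hB, hAB⟩ :=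
          exists_ae_eq_of_universalCompletion Q (rawFiltration_le_univMeas s) hA
        rw [setIntegral_congr_set hAB, setIntegral_congr_set hAB, min_eq_left hs]
        exact hraw s _ (le_min hst hs) (min_le_right t T) B hB
      · rw [min_eq_right hs.le, min_eq_right (hs.le.trans hst)]
  simpa using hneg.neg

end FundamentalValue

/-! ### Robust bubbles and robust martingales -/

section RobustMartingale

variable {d : ℕ} {𝒬 : ℝ≥0 → PathSpace d → Set (ProbabilityMeasure (PathSpace d))}
  {T : ℝ≥0} {S : ℝ≥0 → PathSpace d → ℝ} {Q : ProbabilityMeasure (PathSpace d)}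

/-- If `S` is a robust martingale, then at every deterministic time some prior with the same past
attains the current value of `S` up to `ε`, simultaneously on all events of the past. -/
theorem exists_setIntegral_le_add (h𝒬 : IsStableFamily 𝒬)
    (hS : ∀ Q ∈ priors 𝒬, Supermartingale (fun t => S (min t T)) (starFiltration d) (ext Q))
    (hSm : ∀ t, Measurable[starFiltration d t] (S t))
    (hM : IsRobustMartingaleOn (priors 𝒬) T S) (hQ : Q ∈ priors 𝒬) {t : ℝ≥0} (ht : t ≤ T)
    {ε : ℝ} (hε : 0 < ε) :
    ∃ R ∈ agreeingPriors (priors 𝒬) Q (rawFiltration d t), ∀ D,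
      MeasurableSet[rawFiltration d t] D →
        ∫ ω in D, S t ω ∂(ext Q) ≤ ∫ ω in D, S T ω ∂(ext R) + ε := by
  have hm := rawFiltration_le_univMeas (d := d) t
  have hξ : ∀ Q ∈ priors 𝒬, Integrable (S T) (ext Q) := fun Q hQ =>
    integrable_of_supermartingale (hS Q hQ) le_rfl
  have hSi := integrable_of_supermartingale (hS Q hQ) ht
  obtain ⟨R, hR, hle⟩ := exists_integral_le_add h𝒬 hQ hξ hSi
    (fun R hR => condExp_le_of_supermartingale hS hSm ht hR) (hM.eq_essSup t T ht le_rfl Q hQ) hε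
  refine ⟨R, hR, fun D hD => ?_⟩
  have h1 := integral_add_compl (hm _ hD) hSi
  have h2 := integral_add_compl (hm _ hD) (hξ R hR.1)
  have h3 : ∫ ω in Dᶜ, S T ω ∂(ext R) ≤ ∫ ω in Dᶜ, S t ω ∂(ext Q) := by
    rw [← setIntegral_condExp_of_agree hm hR (hξ R hR.1) hD.compl]
    exact setIntegral_mono_ae (integrable_condExp_of_agree hm hR).integrableOn hSi.integrableOn
      (condExp_le_of_supermartingale hS hSm ht hR)
  linarith

/-- Pasting nearly optimal priors successively at the times `t k` on disjoint events `A k` of the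
respective pasts. -/
theorem exists_paste_along_times (h𝒬 : IsStableFamily 𝒬)
    (hS : ∀ Q ∈ priors 𝒬, Supermartingale (fun t => S (min t T)) (starFiltration d) (ext Q))
    (hSm : ∀ t, Measurable[starFiltration d t] (S t))
    (hM : IsRobustMartingaleOn (priors 𝒬) T S) (hQ : Q ∈ priors 𝒬) {t : ℕ → ℝ≥0}
    {A : ℕ → Set (PathSpace d)} (hA : ∀ k, MeasurableSet[rawFiltration d (t k)] (A k))
    (hdisj : Pairwise (Function.onFun Disjoint A)) {ε : ℝ} (hε : 0 < ε) (n : ℕ)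
    (ht : ∀ k < n, t k ≤ T) :
    ∃ P ∈ priors 𝒬,
      (∀ k < n, ∀ D, MeasurableSet[rawFiltration d (t k)] D → D ⊆ A k →
        ext P D = ext Q D ∧ ∫ ω in D, S (t k) ω ∂(ext Q) ≤ ∫ ω in D, S T ω ∂(ext P) + ε) ∧
      ∀ D : Set (PathSpace d), (∀ k < n, D ⊆ (A k)ᶜ) → ext P D = ext Q D := by
  induction n with
  | zero => exact ⟨Q, hQ, fun k hk => absurd hk (Nat.not_lt_zero k), fun _ _ => rfl⟩
  | succ n ih =>
    obtain ⟨P, hP, h1, h2⟩ := ih fun k hk => ht k (hk.trans n.lt_succ_self)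
    obtain ⟨R, hR, h3⟩ := exists_setIntegral_le_add h𝒬 hS hSm hM hP (ht n n.lt_succ_self) hε
    obtain ⟨P', hP', he⟩ := exists_paste h𝒬 hP hR.1 hR.2 (hA n)
    have hAn : MeasurableSet (A n) := (rawFiltration d).le _ _ (hA n)
    have hin : ∀ D, D ⊆ A n → ext P' D = ext R D := fun D hD => by
      rw [ext_paste_apply hAn he, Set.inter_eq_left.mpr hD,
        (Set.disjoint_compl_right_iff_subset.mpr hD).inter_eq, measure_empty, add_zero]
    have hout : ∀ D, D ⊆ (A n)ᶜ → ext P' D = ext P D := fun D hD => by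
      rw [ext_paste_apply hAn he, Set.inter_eq_left.mpr hD,
        (Set.subset_compl_iff_disjoint_right.mp hD).inter_eq, measure_empty, zero_add]
    have hdis : ∀ k < n, A k ⊆ (A n)ᶜ := fun k hk =>
      Set.subset_compl_iff_disjoint_right.mpr (hdisj hk.ne)
    refine ⟨P', hP', fun k hk D hD hDA => ?_, fun D hD => ?_⟩
    · rcases Nat.lt_succ_iff_lt_or_eq.mp hk with hk' | rfl
      · have hDn := hDA.trans (hdis k hk')
        rw [hout D hDn, (setIntegral_paste hAn he (S T)).2 hDn]
        exact h1 k hk' D hD hDA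
      -- On `A k`, the prior `P` of the earlier pastings still coincides with `Q`.
      · have hPQ : ∀ D, D ⊆ A k → ext P D = ext Q D := fun D hDA => h2 D fun j hj =>
          hDA.trans (Set.subset_compl_iff_disjoint_right.mpr (hdisj hj.ne'))
        have hres : (ext P).restrict D = (ext Q).restrict D := by
          have hDm : MeasurableSet[univMeas d] D := rawFiltration_le_univMeas _ _ hD
          refine @Measure.ext _ (univMeas d) _ _ fun B _ => ?_
          rw [Measure.restrict_apply' hDm, Measure.restrict_apply' hDm]
          exact hPQ _ (Set.inter_subset_right.trans hDA)
        rw [hin D hDA, hR.2 D hD, (setIntegral_paste hAn he (S T)).1 hDA, ← hres]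
        exact ⟨hPQ D hDA, h3 D hD⟩
    · rw [hout D (hD n n.lt_succ_self)]
      exact h2 D fun k hk => hD k (hk.trans n.lt_succ_self)

end RobustMartingale

/-! ### Grid approximation of stopping times -/

section Discretization

variable {d : ℕ} {𝒬 : ℝ≥0 → PathSpace d → Set (ProbabilityMeasure (PathSpace d))}
  {T : ℝ≥0} {S : ℝ≥0 → PathSpace d → ℝ} {Q : ProbabilityMeasure (PathSpace d)}
  {τ : PathSpace d → ℝ≥0}

/-- The `k`-th point of the equidistant grid of `[0, T]` with `N + 1` intervals. -/
noncomputable def gridTime (T : ℝ≥0) (N k : ℕ) : ℝ≥0 := k * (T / (N + 1))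

theorem gridTime_le {N k : ℕ} (hk : k < N + 2) : gridTime T N k ≤ T := by
  have h1 : (k : ℝ≥0) ≤ N + 1 := by exact_mod_cast Nat.lt_succ_iff.mp hk
  calc gridTime T N k ≤ ((N : ℝ≥0) + 1) * (T / (N + 1)) := by unfold gridTime; gcongr
    _ = T := mul_div_cancel₀ T (by positivity)

/-- The event that the grid point `gridTime T N k` is the first one after `τ`. -/
def gridEvent (T : ℝ≥0) (τ : PathSpace d → ℝ≥0) (N : ℕ) : ℕ → Set (PathSpace d) :=
  disjointed fun k => {ω | τ ω ≤ gridTime T N k}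

theorem measurableSet_gridEvent (hτ : IsRawStoppingTime τ) (N k : ℕ) :
    MeasurableSet[rawFiltration d (gridTime T N k)] (gridEvent T τ N k) := by
  have hle : ∀ t, MeasurableSet[rawFiltration d t] {ω | τ ω ≤ t} := fun t => by
    simpa only [WithTop.coe_le_coe] using hτ t
  rw [gridEvent, disjointed_eq_inter_compl]
  refine (hle _).inter (MeasurableSet.iInter fun i => MeasurableSet.iInter fun hi => ?_)
  refine (rawFiltration d).mono ?_ _ (hle (gridTime T N i)).compl
  unfold gridTime
  gcongr

theorem exists_mem_gridEvent (hτT : ∀ ω, τ ω ≤ T) (N : ℕ) (ω : PathSpace d) :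
    ∃ k < N + 2, ω ∈ gridEvent T τ N k ∧ τ ω ≤ gridTime T N k ∧
      gridTime T N k ≤ τ ω + T / (N + 1) := by
  classical
  have hex : ∃ k, τ ω ≤ gridTime T N k := ⟨N + 1, by
    have : gridTime T N (N + 1) = T := by
      unfold gridTime
      push_cast
      exact mul_div_cancel₀ T (by positivity)
    rw [this]; exact hτT ω⟩
  have hspec := Nat.find_spec hex
  refine ⟨Nat.find hex, ?_, ?_, hspec, ?_⟩
  · refine Nat.lt_succ_of_le (Nat.find_min' hex ?_)
    have : gridTime T N (N + 1) = T := by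
      unfold gridTime
      push_cast
      exact mul_div_cancel₀ T (by positivity)
    rw [this]; exact hτT ω
  · rw [gridEvent, disjointed_eq_inter_compl]
    exact ⟨hspec, Set.mem_iInter₂.mpr fun i hi => Nat.find_min hex hi⟩
  · rcases hk : Nat.find hex with _ | k
    · simp [gridTime]
    · have hlt : gridTime T N k < τ ω :=
        not_le.mp (Nat.find_min hex (by rw [hk]; exact k.lt_succ_self))
      have : gridTime T N (k + 1) = gridTime T N k + T / (N + 1) := by
        unfold gridTime; push_cast; ring
      rw [this]
      gcongr

/-- The value of the process at the first grid point after `τ`. -/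
noncomputable def gridValue (T : ℝ≥0) (S : ℝ≥0 → PathSpace d → ℝ) (τ : PathSpace d → ℝ≥0)
    (N : ℕ) (ω : PathSpace d) : ℝ :=
  ∑ k ∈ Finset.range (N + 2), (gridEvent T τ N k).indicator (S (gridTime T N k)) ω

theorem gridValue_eq {N k : ℕ} (hk : k < N + 2) {ω : PathSpace d} (h : ω ∈ gridEvent T τ N k) :
    gridValue T S τ N ω = S (gridTime T N k) ω := by
  rw [gridValue, Finset.sum_eq_single k, Set.indicator_of_mem h]
  · intro j _ hj
    refine Set.indicator_of_notMem (fun hj' => ?_) _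
    exact Set.disjoint_left.mp (disjoint_disjointed _ hj) hj' h
  · exact fun h' => absurd (Finset.mem_range.mpr hk) h'

theorem tendsto_gridValue (hτT : ∀ ω, τ ω ≤ T)
    (hr : ∀ ω t, ContinuousWithinAt (fun u => S u ω) (Set.Ici t) t) (ω : PathSpace d) :
    Tendsto (fun N => gridValue T S τ N ω) atTop (𝓝 (S (τ ω) ω)) := by
  choose k hk hmem hge hle using fun N => exists_mem_gridEvent hτT N ω
  have h1 : (fun N => gridValue T S τ N ω) = fun N => S (gridTime T N (k N)) ω :=
    funext fun N => gridValue_eq (hk N) (hmem N)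
  have h2 : Tendsto (fun N : ℕ => τ ω + T / ((N : ℝ≥0) + 1)) atTop (𝓝 (τ ω)) := by
    have h3 : Tendsto (fun N : ℕ => T / ((N : ℝ≥0) + 1)) atTop (𝓝 0) := by
      rw [← NNReal.tendsto_coe]
      push_cast
      simpa [div_eq_mul_inv] using
        (tendsto_one_div_add_atTop_nhds_zero_nat (𝕜 := ℝ)).const_mul (T : ℝ)
    simpa using h3.const_add (τ ω)
  have h4 : Tendsto (fun N => gridTime T N (k N)) atTop (𝓝[≥] (τ ω)) :=
    tendsto_nhdsWithin_iff.mpr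
      ⟨tendsto_of_tendsto_of_tendsto_of_le_of_le tendsto_const_nhds h2 hge hle,
        Eventually.of_forall hge⟩
  rw [h1]
  exact (hr ω (τ ω)).tendsto.comp h4

theorem measurable_gridValue (hSm : ∀ t, Measurable[starFiltration d t] (S t))
    (hτ : IsRawStoppingTime τ) (N : ℕ) : Measurable[univMeas d] (gridValue T S τ N) :=
  @Finset.measurable_fun_sum _ _ _ _ _ _ (univMeas d) _ _ fun k _ =>
    ((hSm _).mono ((starFiltration d).le _) le_rfl).indicator
      (rawFiltration_le_univMeas _ _ (measurableSet_gridEvent hτ N k))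

/-- If `S` is a robust martingale, some prior with the same past up to `τ` attains the value of `S`
at the first grid point after `τ` up to a small error. -/
theorem exists_prior_gridValue (h𝒬 : IsStableFamily 𝒬)
    (hS : ∀ Q ∈ priors 𝒬, Supermartingale (fun t => S (min t T)) (starFiltration d) (ext Q))
    (hSm : ∀ t, Measurable[starFiltration d t] (S t))
    (hM : IsRobustMartingaleOn (priors 𝒬) T S) (hQ : Q ∈ priors 𝒬)
    (hτ : IsRawStoppingTime τ) (hτT : ∀ ω, τ ω ≤ T) (N : ℕ) :
    ∃ P ∈ agreeingPriors (priors 𝒬) Q (rawSigma hτ), ∀ D, MeasurableSet[rawSigma hτ] D →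
      ∫ ω in D, gridValue T S τ N ω ∂(ext Q) ≤ ∫ ω in D, S T ω ∂(ext P) + 1 / ((N : ℝ) + 1) := by
  have hdisj : Pairwise (Function.onFun Disjoint (gridEvent T τ N)) := disjoint_disjointed _
  have hA : ∀ k, MeasurableSet[univMeas d] (gridEvent T τ N k) := fun k =>
    rawFiltration_le_univMeas _ _ (measurableSet_gridEvent hτ N k)
  obtain ⟨P, hP, h1, -⟩ := exists_paste_along_times h𝒬 hS hSm hM hQ
    (measurableSet_gridEvent (T := T) hτ N) hdisj
    (ε := 1 / (((N : ℝ) + 1) * ((N : ℝ) + 2))) (by positivity) (N + 2)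
    fun k hk => gridTime_le hk
  have hDA : ∀ D, MeasurableSet[rawSigma hτ] D → ∀ k,
      MeasurableSet[rawFiltration d (gridTime T N k)] (D ∩ gridEvent T τ N k) := by
    intro D hD k
    have h2 : D ∩ gridEvent T τ N k
        = (D ∩ {ω | (τ ω : WithTop ℝ≥0) ≤ gridTime T N k}) ∩ gridEvent T τ N k := by
      ext ω
      refine ⟨fun h => ⟨⟨h.1, ?_⟩, h.2⟩, fun h => ⟨h.1.1, h.2⟩⟩
      exact WithTop.coe_le_coe.mpr
        (disjointed_subset (fun k => {ω | τ ω ≤ gridTime T N k}) k h.2)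
    rw [h2]
    exact (hD.2 _).inter (measurableSet_gridEvent hτ N k)
  have hcover : ∀ D : Set (PathSpace d),
      D = ⋃ k ∈ Finset.range (N + 2), D ∩ gridEvent T τ N k := by
    intro D
    ext ω
    simp only [Set.mem_iUnion, Finset.mem_range, exists_prop, Set.mem_inter_iff]
    refine ⟨fun h => ?_, fun ⟨_, _, h, _⟩ => h⟩
    obtain ⟨k, hk, hmem, -⟩ := exists_mem_gridEvent hτT N ω
    exact ⟨k, hk, h, hmem⟩
  have hpd : ∀ D : Set (PathSpace d), (Finset.range (N + 2) : Set ℕ).PairwiseDisjoint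
      fun k => D ∩ gridEvent T τ N k := fun D i _ j _ hij =>
    (hdisj hij).mono Set.inter_subset_right Set.inter_subset_right
  have hmD : ∀ D, MeasurableSet[rawSigma hτ] D → ∀ k ∈ Finset.range (N + 2),
      MeasurableSet[univMeas d] (D ∩ gridEvent T τ N k) := fun D hD k _ =>
    rawFiltration_le_univMeas _ _ (hDA D hD k)
  refine ⟨P, ⟨hP, fun D hD => ?_⟩, fun D hD => ?_⟩
  · rw [hcover D, measure_biUnion_finset (hpd D) (hmD D hD),
      measure_biUnion_finset (hpd D) (hmD D hD)]
    exact Finset.sum_congr rfl fun k hk =>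
      (h1 k (Finset.mem_range.mp hk) _ (hDA D hD k) Set.inter_subset_right).1
  · have hSi : ∀ k < N + 2, Integrable (S (gridTime T N k)) (ext Q) := fun k hk =>
      integrable_of_supermartingale (hS Q hQ) (gridTime_le hk)
    have e1 : ∫ ω in D, gridValue T S τ N ω ∂(ext Q)
        = ∑ k ∈ Finset.range (N + 2),
          ∫ ω in D ∩ gridEvent T τ N k, S (gridTime T N k) ω ∂(ext Q) := by
      unfold gridValue
      rw [integral_finsetSum _ fun k hk =>
        ((hSi k (Finset.mem_range.mp hk)).indicator (hA k)).integrableOn]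
      exact Finset.sum_congr rfl fun k _ => setIntegral_indicator (hA k)
    have e2 : ∫ ω in D, S T ω ∂(ext P)
        = ∑ k ∈ Finset.range (N + 2), ∫ ω in D ∩ gridEvent T τ N k, S T ω ∂(ext P) := by
      conv_lhs => rw [hcover D]
      exact integral_biUnion_finset _ (hmD D hD) (hpd D) fun k _ =>
        (integrable_of_supermartingale (hS P hP) le_rfl).integrableOn
    have e3 : ∑ _k ∈ Finset.range (N + 2), 1 / (((N : ℝ) + 1) * ((N : ℝ) + 2))
        = 1 / ((N : ℝ) + 1) := by
      rw [Finset.sum_const, Finset.card_range, nsmul_eq_mul]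
      push_cast
      field_simp
    rw [e1, e2, ← e3, ← Finset.sum_add_distrib]
    exact Finset.sum_le_sum fun k hk =>
      (h1 k (Finset.mem_range.mp hk) _ (hDA D hD k) Set.inter_subset_right).2

/-- A robust martingale is dominated at stopping times by its conditional sublinear expectation.
The stopping time is approximated from the right by grid times, where nearly optimal priors can be
pasted together, and Fatou's lemma passes to the limit. -/
theorem le_of_robustMartingale (h𝒬 : IsStableFamily 𝒬)
    (hS : ∀ Q ∈ priors 𝒬, Supermartingale (fun t => S (min t T)) (starFiltration d) (ext Q))
    (hSm : ∀ t, Measurable[starFiltration d t] (S t))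
    (hr : ∀ ω t, ContinuousWithinAt (fun u => S u ω) (Set.Ici t) t)
    (hnn : ∀ Q ∈ priors 𝒬, ∀ᵐ ω ∂(ext Q), ∀ t ≤ T, 0 ≤ S t ω)
    (hM : IsRobustMartingaleOn (priors 𝒬) T S) (hQ : Q ∈ priors 𝒬)
    (hτ : IsRawStoppingTime τ) (hτT : ∀ ω, τ ω ≤ T) {V : PathSpace d → ℝ}
    (hV : IsConditionalSublinearExpectation (priors 𝒬) Q (rawSigma hτ) (S T) V) :
    ∀ᵐ ω ∂(ext Q), S (τ ω) ω ≤ V ω := by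
  have hm : rawSigma hτ ≤ univMeas d := (rawSigma_le hτ).trans borel_le_univMeas
  have hgm := fun N => measurable_gridValue (T := T) hSm hτ N
  have hlim := tendsto_gridValue hτT hr
  have hSτ : Measurable[univMeas d] fun ω => S (τ ω) ω :=
    @measurable_of_tendsto_metrizable _ _ (univMeas d) _ _ _ _ _ _ hgm (tendsto_pi_nhds.mpr hlim)
  obtain ⟨G, hG, hSG⟩ := exists_ae_eq_rawSigma_measurable hSm hτ hSτ Q
  choose P hP hPle using exists_prior_gridValue h𝒬 hS hSm hM hQ hτ hτT
  let Y : ℕ → PathSpace d → ℝ := fun N => (ext (P N))[S T | rawSigma hτ]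
  have hYm : ∀ N, StronglyMeasurable[rawSigma hτ] (Y N) := fun N => stronglyMeasurable_condExp
  have hYV : ∀ᵐ ω ∂(ext Q), ∀ N, Y N ω ≤ V ω :=
    ae_all_iff.mpr fun N => hV.2.1 _ ⟨P N, hP N, rfl⟩
  have hYnn : ∀ N, 0 ≤ᵐ[ext Q] Y N := fun N =>
    ae_of_agree hm (hP N).2 (p := fun ω => 0 ≤ Y N ω) (le_universalCompletion _ _
      (StronglyMeasurable.measurableSet_le stronglyMeasurable_const (hYm N)))
      (condExp_nonneg ((hnn _ (hP N).1).mono fun _ h => h T le_rfl))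
  have hgnn : ∀ N, 0 ≤ᵐ[ext Q] gridValue T S τ N := by
    intro N
    filter_upwards [hnn Q hQ] with ω hω
    obtain ⟨k, hk, hmem, -⟩ := exists_mem_gridEvent hτT N ω
    rw [gridValue_eq hk hmem]
    exact hω _ (gridTime_le hk)
  have hgi : ∀ N, Integrable (gridValue T S τ N) (ext Q) := fun N =>
    integrable_finsetSum _ fun k hk => (integrable_of_supermartingale (hS Q hQ)
      (gridTime_le (Finset.mem_range.mp hk))).indicator
      (rawFiltration_le_univMeas _ _ (measurableSet_gridEvent hτ N k))
  -- The essential supremum `V` need not be `F_τ`-measurable, so the comparison with the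
  -- `F_τ`-measurable version `G` of `S τ` is made for a smaller `F_τ`-measurable variable.
  let W : PathSpace d → ℝ≥0∞ := fun ω => ⨆ N, ENNReal.ofReal (Y N ω)
  have hWm : Measurable[rawSigma hτ] W :=
    Measurable.iSup fun N => (hYm N).measurable.ennreal_ofReal
  have hset : ∀ D, MeasurableSet[rawSigma hτ] D →
      ∫⁻ ω in D, ENNReal.ofReal (S (τ ω) ω) ∂(ext Q) ≤ ∫⁻ ω in D, W ω ∂(ext Q) := by
    intro D hD
    have hstep : ∀ N : ℕ, ∫⁻ ω in D, ENNReal.ofReal (gridValue T S τ N ω) ∂(ext Q)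
        ≤ ∫⁻ ω in D, W ω ∂(ext Q) + ENNReal.ofReal (1 / ((N : ℝ) + 1)) := by
      intro N
      have hYi := integrable_condExp_of_agree (ξ := S T) hm (hP N)
      rw [← ofReal_integral_eq_lintegral_ofReal (hgi N).restrict (ae_restrict_of_ae (hgnn N))]
      refine (ENNReal.ofReal_le_ofReal (hPle N D hD)).trans (ENNReal.ofReal_add_le.trans ?_)
      gcongr
      rw [← setIntegral_condExp_of_agree hm (hP N)
        (integrable_of_supermartingale (hS _ (hP N).1) le_rfl) hD,
        ofReal_integral_eq_lintegral_ofReal hYi.restrict (ae_restrict_of_ae (hYnn N))]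
      exact lintegral_mono fun ω => le_iSup (fun N => ENNReal.ofReal (Y N ω)) N
    have hzero : Tendsto (fun N : ℕ => ∫⁻ ω in D, W ω ∂(ext Q)
        + ENNReal.ofReal (1 / ((N : ℝ) + 1))) atTop (𝓝 (∫⁻ ω in D, W ω ∂(ext Q))) := by
      have := (ENNReal.tendsto_ofReal (tendsto_one_div_add_atTop_nhds_zero_nat (𝕜 := ℝ))).const_add
        (∫⁻ ω in D, W ω ∂(ext Q))
      simpa using this
    calc ∫⁻ ω in D, ENNReal.ofReal (S (τ ω) ω) ∂(ext Q)
        = ∫⁻ ω in D, liminf (fun N => ENNReal.ofReal (gridValue T S τ N ω)) atTop ∂(ext Q) :=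
          lintegral_congr fun ω => (ENNReal.tendsto_ofReal (hlim ω)).liminf_eq.symm
      _ ≤ liminf (fun N => ∫⁻ ω in D, ENNReal.ofReal (gridValue T S τ N ω) ∂(ext Q)) atTop :=
          lintegral_liminf_le fun N => (hgm N).ennreal_ofReal
      _ ≤ liminf (fun N : ℕ => ∫⁻ ω in D, W ω ∂(ext Q)
            + ENNReal.ofReal (1 / ((N : ℝ) + 1))) atTop :=
          liminf_le_liminf (Eventually.of_forall hstep)
      _ = ∫⁻ ω in D, W ω ∂(ext Q) := hzero.liminf_eq
  have hGW : (fun ω => ENNReal.ofReal (G ω)) ≤ᵐ[(ext Q).trim hm] W := by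
    refine @ae_le_of_forall_setLIntegral_le_of_sigmaFinite _ (rawSigma hτ) _ _ _ _
      hG.ennreal_ofReal fun D hD _ => ?_
    rw [restrict_trim hm _ hD, lintegral_trim hm hG.ennreal_ofReal, lintegral_trim hm hWm]
    refine le_trans (le_of_eq ?_) (hset D hD)
    exact lintegral_congr_ae (ae_restrict_of_ae (hSG.mono fun ω h => by
      change ENNReal.ofReal (G ω) = ENNReal.ofReal (S (τ ω) ω)
      rw [← h]))
  filter_upwards [ae_of_ae_trim hm hGW, hSG, hYV, hYnn 0] with ω h1 h2 h3 h4
  have h5 : W ω ≤ ENNReal.ofReal (V ω) := iSup_le fun N => ENNReal.ofReal_le_ofReal (h3 N)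
  have h6 : S (τ ω) ω = G ω := h2
  rw [h6]
  exact (ENNReal.ofReal_le_ofReal_iff (le_trans h4 (h3 0))).mp (h1.trans h5)

end Discretization

theorem uniformContinuous_stopped {f : ℝ≥0 → ℝ} (hf : Continuous f) (T : ℝ≥0) :
    UniformContinuous fun u => f (min u T) := by
  have h1 : UniformContinuousOn f (Set.Icc 0 T) :=
    isCompact_Icc.uniformContinuousOn_of_continuous hf.continuousOn
  rw [Metric.uniformContinuousOn_iff] at h1
  refine Metric.uniformContinuous_iff.mpr fun ε hε => ?_
  obtain ⟨δ, hδ, h⟩ := h1 ε hε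
  refine ⟨δ, hδ, fun {a b} hab => h _ ⟨zero_le, min_le_right _ _⟩ _
    ⟨zero_le, min_le_right _ _⟩ (lt_of_le_of_lt ?_ hab)⟩
  rw [NNReal.dist_eq, NNReal.dist_eq]
  push_cast
  refine (abs_min_sub_min_le_max _ _ _ _).trans ?_
  simp

end RobustBubble

open RobustBubble in
theorem mainTheorem1 (d : ℕ)
    (𝒬 : ℝ≥0 → RobustBubble.PathSpace d → Set (ProbabilityMeasure (RobustBubble.PathSpace d)))
    (h𝒬 : RobustBubble.IsStableFamily 𝒬)
    (T : ℝ≥0) (S : ℝ≥0 → RobustBubble.PathSpace d → ℝ)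
    (hS_adapted : ∀ t, Measurable[RobustBubble.starFiltration d t] (S t))
    (hS_right : ∀ ω t, ContinuousWithinAt (fun u => S u ω) (Set.Ici t) t)
    (hS_cont : ∀ Q ∈ RobustBubble.priors 𝒬, ∀ᵐ ω ∂(RobustBubble.ext Q),
      Continuous (fun u => S u ω))
    (hS_nonneg : ∀ Q ∈ RobustBubble.priors 𝒬, ∀ᵐ ω ∂(RobustBubble.ext Q),
      ∀ t ≤ T, 0 ≤ S t ω)
    (hS_local : ∀ Q ∈ RobustBubble.priors 𝒬, RobustBubble.IsLocalMartingaleOn T S Q)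
    (Sstar : ℝ≥0 → RobustBubble.PathSpace d → ℝ)
    (hSstar : RobustBubble.IsRobustFundamentalValue (RobustBubble.priors 𝒬) T S Sstar) :
    (∀ Q ∈ RobustBubble.priors 𝒬,
      (∀ t ≤ T, ∀ᵐ ω ∂(RobustBubble.ext Q), 0 ≤ S t ω - Sstar t ω) ∧
      RobustBubble.IsLocalSubmartingaleOn T (fun t ω => S t ω - Sstar t ω) Q ∧
      (∀ᵐ ω ∂(RobustBubble.ext Q), S T ω - Sstar T ω = 0)) ∧
    (RobustBubble.HasRobustBubble (RobustBubble.priors 𝒬) T S →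
      ¬ RobustBubble.IsRobustMartingaleOn (RobustBubble.priors 𝒬) T S) := by
  -- All paths start at `0`, so `S 0` is constant and in particular integrable.
  have hS0 : ∀ ω, S (min 0 T) ω = S 0 (PathSpace.zero d) := fun ω => by
    rw [min_eq_left zero_le]
    refine eq_of_agree_star (hS_adapted 0) fun u hu => ?_
    rw [nonpos_iff_eq_zero.mp hu, ω.2, (PathSpace.zero d).2]
  have hX : ∀ t, Measurable[starFiltration d t] (S (min t T)) := fun t =>
    (hS_adapted _).mono ((starFiltration d).mono (min_le_left t T)) le_rfl
  have hnn : ∀ Q ∈ priors 𝒬, ∀ᵐ ω ∂(ext Q), ∀ t, 0 ≤ S (min t T) ω := fun Q hQ =>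
    (hS_nonneg Q hQ).mono fun ω h t => h _ (min_le_right t T)
  have hsuper : ∀ Q ∈ priors 𝒬,
      Supermartingale (fun t => S (min t T)) (starFiltration d) (ext Q) := by
    intro Q hQ
    refine supermartingale_of_locally (hS_local Q hQ) (fun t => (hX t).stronglyMeasurable)
      (hnn Q hQ) ?_
    have : S (min 0 T) = fun _ => S 0 (PathSpace.zero d) := funext hS0
    rw [this]
    exact integrable_const _
  refine ⟨fun Q hQ => ⟨fun t ht => ?_, ?_, ?_⟩, ?_⟩
  · exact (fundamentalValue_le hSstar hsuper hS_adapted hQ ht).mono fun ω h => sub_nonneg.mpr h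
  · refine locally_submartingale_sub (b := S 0 (PathSpace.zero d)) (hS_local Q hQ) hX ?_ ?_ ?_
      (hnn Q hQ) (fun ω => (hS0 ω).le)
      (fundamentalValue_supermartingale h𝒬 hSstar hsuper hS_adapted (hS_nonneg Q hQ) hQ) ?_
    · intro ω t
      exact ContinuousWithinAt.comp (g := fun u => S u ω) (f := fun u => min u T)
        (t := Set.Ici (min t T)) (hS_right ω (min t T))
        (continuous_id.min continuous_const).continuousWithinAt
        fun u hu => min_le_min_right T hu
    · exact (hS_cont Q hQ).mono fun ω h => uniformContinuous_stopped h T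
    · filter_upwards [hS_cont Q hQ] with ω h
      obtain ⟨C, hC⟩ := (isCompact_Icc (a := (0 : ℝ≥0)) (b := T)).exists_bound_of_continuousOn
        h.continuousOn
      exact ⟨C, fun u => (le_abs_self _).trans (hC _ ⟨zero_le, min_le_right u T⟩)⟩
    · intro t
      filter_upwards [fundamentalValue_nonneg hSstar (hS_nonneg Q hQ) hQ (min_le_right t T),
        fundamentalValue_le hSstar hsuper hS_adapted hQ (min_le_right t T)] with ω h1 h2
      exact ⟨h1, h2⟩
  · exact (fundamentalValue_terminal hSstar hsuper hS_adapted hQ).mono fun ω h =>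
      sub_eq_zero.mpr h.symm
  · rintro ⟨τ, hτ, hτT, Q, hQ, V, hV, hpos⟩ hM
    refine hpos.ne' ?_
    have h := le_of_robustMartingale h𝒬 hsuper hS_adapted hS_right hS_nonneg hM hQ hτ hτT hV
    rw [ae_iff] at h
    simpa only [not_le] using h
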